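/- **Setting.** Let $n,m\ge 0$, let $D\subset\mathbb N=\{0,1,2,\dots\}$ be a finite non-empty set of delays, $d_{\max}=\max D$, and let $A\in\mathbb R^{n\times n}$, $B\in\mathbb R^{n\times m}$ and $K(d)\in\mathbb R^{m\times(n+m d_{\max})}$ for $d\in D$. The switched-delay system with linear delay-dependent feedback given by these data has as its trajectories all $(\sigma,x,v)$ with a switching signal $\sigma:\mathbb Z\to D$, states $x(t)\in\mathbb R^n$ $(t\ge0)$ and control signals $v(t)\in\mathbb R^m$ $(t\in\mathbb Z)$ such that for all integers $t\ge 0$ $$x(t+1)=Ax(t)+B\sum_{t'\le t,\ t'+\sigma(t')=t}v(t'),\qquad v(t)=K(\sigma(t))\,\tilde u(t),$$ where $\tilde u(t)=(x(t),u_1(t),\dots,u_{d_{\max}}(t))$ and $u_d(t)=\sum_{t'<t,\ t'+\sigma(t')=t+d-1}v(t')$. The switching signal and the initial data ($x(0)$, and $v(t')$ for $t'<0$) are arbitrary. The worst rate of growth of the system is $$\rho=\sup_{\text{trajectories}}\ \limsup_{t\to\infty}|\tilde u(t)|^{1/t}.$$ An algorithm receives $n,m,D$ exactly. It receives real data (the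 entries of $A$, $B$, $K(d)$, and a number $r$) through arbitrary dyadic names: a name of $a\in\mathbb R$ is a sequence of integers $(p_k)_{k\ge0}$ with $|a-p_k2^{-k}|\le2^{-k}$. A fixed (Turing) computable procedure is called for $k=0,1,2,\dots$ on $k$ and the $k$-th approximations of all the data, until, after finitely many calls, it returns an answer. **Statement.** For every real $\varepsilon>0$ the following hold. 1. There is an algorithm which, for all $n,m,D,A,B,K$ as above and every name of the data, stops after finitely many steps and returns a rational number $c$ with $|\rho-c|\le\varepsilon$; in particular $\rho<\infty$. 2. There is an algorithm which, for all $n,m,D,A,B,K$ as above, every real $r>0$ and every name of the data and of $r$, stops after finitely many steps and returns one of the following two assertions, and the assertion that it returns is true: - there is $C\in\mathbb R$ such that $|\tilde u(t)|\le C\,|\tilde u(0)|\,(r+\varepsilon)^t$ for all trajectories and all $t\ge0$; - there are $C>0$ and a trajectory with $|\tilde u(t)|\ge C\,\max(r-\varepsilon,0)^t$ for all $t\ge0$ (with $0^0=1$). -/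

import Mathlib

open scoped ENNReal

/-- A linear plant `x(t+1) = A x(t) + B u(t)` with `n` states and `m` inputs, together with a
linear delay-dependent feedback `d ↦ K(d)`, for the finite set `D` of possible delays.  With
`d_max = max D`, the columns of `K(d)` are indexed by the coordinates of
`ũ = (x, u_1, …, u_{d_max})`: `Sum.inl j` is the `j`-th coordinate of `x`, and `Sum.inr (s, j)`
the `j`-th coordinate of `u_{s+1}`.  The entries are in `R`: real for a system, integers for
the numerators of a dyadic approximation of a system. -/
structure SwitchedDelaySystem (n m : ℕ) (D : Finset ℕ) (R : Type) where
  A : Matrix (Fin n) (Fin n) R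
  B : Matrix (Fin n) (Fin m) R
  K : D → Matrix (Fin m) (Fin n ⊕ Fin (D.sup id) × Fin m) R

namespace SwitchedDelaySystem

variable {n m : ℕ} {D : Finset ℕ}

/-! ### Dynamics -/

/-- `∑ v(t')` over all `t' < t` with `t' + σ(t') = t + s`: what was sent before time `t` and
reaches the actuator at time `t + s`.  (All such `t'` satisfy `t' ≥ t - max D`.) -/
noncomputable def pending (σ : ℤ → D) (v : ℤ → Fin m → ℝ) (t : ℤ) (s : ℕ) : Fin m → ℝ :=
  ∑ t' ∈ (Finset.Ico (t - (D.sup id : ℕ)) t).filter (fun t' => t' + ((σ t' : ℕ) : ℤ) = t + s),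
    v t'

/-- `u(t) = ∑ v(t')` over all `t' ≤ t` with `t' + σ(t') = t`: the input that the plant receives
at time `t`, which is zero if nothing arrives.  (All such `t'` satisfy `t' ≥ t - max D`.) -/
noncomputable def plantInput (σ : ℤ → D) (v : ℤ → Fin m → ℝ) (t : ℤ) : Fin m → ℝ :=
  ∑ t' ∈ (Finset.Icc (t - (D.sup id : ℕ)) t).filter (fun t' => t' + ((σ t' : ℕ) : ℤ) = t), v t'

/-- The extended state `ũ(t) = (x(t), u_1(t), …, u_{d_max}(t))`, where `u_{s+1}(t)` is the part
of the input at time `t + s` that was sent before time `t`. -/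
noncomputable def extState (σ : ℤ → D) (x : ℕ → Fin n → ℝ) (v : ℤ → Fin m → ℝ) (t : ℕ) :
    Fin n ⊕ Fin (D.sup id) × Fin m → ℝ :=
  Sum.elim (x t) (fun p => pending σ v t p.1 p.2)

/-- A trajectory of the closed loop: an arbitrary switching signal `σ`, arbitrary initial data
(`x(0)` and the signals sent at negative times), and for all times `t ≥ 0` the equations of the
plant and of the delay-dependent feedback. -/
structure Trajectory (S : SwitchedDelaySystem n m D ℝ) where
  σ : ℤ → D
  x : ℕ → Fin n → ℝ
  v : ℤ → Fin m → ℝ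
  plant : ∀ t : ℕ, x (t + 1) = S.A.mulVec (x t) + S.B.mulVec (plantInput σ v t)
  feedback : ∀ t : ℕ, v t = (S.K (σ t)).mulVec (extState σ x v t)

/-- The norm `|ũ(t)|` along a trajectory (the maximum norm; as all norms are equivalent, the
choice affects neither growth rates nor the existence of constants below). -/
noncomputable def Trajectory.size {S : SwitchedDelaySystem n m D ℝ} (τ : S.Trajectory) (t : ℕ) :
    ℝ :=
  ‖extState τ.σ τ.x τ.v t‖

/-- The worst rate of growth: the supremum over all trajectories of `limsup |ũ(t)|^(1/t)`. -/
noncomputable def growthRate (S : SwitchedDelaySystem n m D ℝ) : ℝ≥0∞ :=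
  ⨆ τ : S.Trajectory,
    Filter.limsup (fun t : ℕ => ENNReal.ofReal (τ.size t) ^ (1 / (t : ℝ))) Filter.atTop

/-- All trajectories are bounded by `C ρ^t`, with `C` proportional to the size of the initial
condition and otherwise uniform. -/
def GrowthAtMost (S : SwitchedDelaySystem n m D ℝ) (ρ : ℝ) : Prop :=
  ∃ C : ℝ, ∀ τ : S.Trajectory, ∀ t : ℕ, τ.size t ≤ C * τ.size 0 * ρ ^ t

/-- For some `C > 0`, some trajectory is bounded from below by `C ρ^t`. -/
def GrowthAtLeast (S : SwitchedDelaySystem n m D ℝ) (ρ : ℝ) : Prop :=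
  ∃ C : ℝ, 0 < C ∧ ∃ τ : S.Trajectory, ∀ t : ℕ, C * ρ ^ t ≤ τ.size t

end SwitchedDelaySystem

/-! ### Real data as input of an algorithm -/

/-- The integer sequence `p` is a (dyadic) name of the real number `a`:
`|a - p k / 2 ^ k| ≤ 1 / 2 ^ k` for all `k`. -/
def IsDyadicName (a : ℝ) (p : ℕ → ℤ) : Prop :=
  ∀ k : ℕ, |a - (p k : ℝ) / 2 ^ k| ≤ 1 / 2 ^ k

/-- The format of the finite input: `n`, `m`, the rows of `A`, the rows of `B`, and the list of
all delays, each with the rows of its feedback matrix. -/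
abbrev SystemCode : Type :=
  ℕ × ℕ × List (List ℤ) × List (List ℤ) × List (ℕ × List (List ℤ))

namespace SwitchedDelaySystem

variable {n m : ℕ} {D : Finset ℕ}

/-- `q k` lists, for every `k`, numerators of approximations of all entries of `S` with common
denominator `2 ^ k` and precision `1 / 2 ^ k`. -/
def IsName (S : SwitchedDelaySystem n m D ℝ) (q : ℕ → SwitchedDelaySystem n m D ℤ) : Prop :=
  (∀ i j, IsDyadicName (S.A i j) fun k => (q k).A i j) ∧
  (∀ i j, IsDyadicName (S.B i j) fun k => (q k).B i j) ∧
  (∀ d i j, IsDyadicName (S.K d i j) fun k => (q k).K d i j)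

/-- The integer arrays `q` written out as lists, delays in increasing order, and the rows of a
feedback matrix in the order `x, u_1, …, u_{d_max}`. -/
def code (q : SwitchedDelaySystem n m D ℤ) : SystemCode :=
  (n, m,
    List.ofFn fun i => List.ofFn fun j => q.A i j,
    List.ofFn fun i => List.ofFn fun j => q.B i j,
    (D.sort (· ≤ ·)).attach.map fun d =>
      (d.1, List.ofFn fun i =>
        (List.ofFn fun j => q.K ⟨d.1, (Finset.mem_sort _).1 d.2⟩ i (Sum.inl j)) ++
        (List.ofFn fun s => List.ofFn fun j =>
          q.K ⟨d.1, (Finset.mem_sort _).1 d.2⟩ i (Sum.inr (s, j))).flatten))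

end SwitchedDelaySystem

/-- How a procedure `f` is run on real data that are presented by a sequence `q` of finite
approximations: for `k = 0, 1, 2, …` it is given the precision level `k` and `q k`, and
either asks for the next precision level (`none`) or stops and returns an answer.  `Outputs f q b`
says that the run stops after finitely many steps, and that `b` is the answer. -/
def Outputs {α β : Type} (f : ℕ × α → Option β) (q : ℕ → α) (b : β) : Prop :=
  ∃ k : ℕ, f (k, q k) = some b ∧ ∀ j < k, f (j, q j) = none

/-! One time step acts on the extended state by a linear map that depends only on the current delay.
The closed loop is therefore a linear system that switches arbitrarily among the finitely many
matrices `trans d`, and its worst rate of growth is their joint spectral radius. Every initial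
extended state and every sequence of delays occurs (`exists_trajectory`). If all products of length
`l` are `O(c ^ l)` (`ProductsBounded`), the trajectories have a uniform upper bound; if not,
compactness yields a single trajectory with `|ũ(t)| ≥ c ^ t`
(`exists_signal_of_not_productsBounded`). It remains to recognize boundedness and its failure, up to
a small gap in the rate, from finitely many products.

Let `N` be the dimension and `X` a bound for the entries of the products of length `L`. If `N * X ≤
c ^ L`, cutting words into blocks of length `L` proves boundedness at rate `c`. The converse test is
an inequality of Bochi type (`abs_prod_le_of_bounded`): boundedness at rate `c` forces the entries
of the products of length `N * L` to be at most `const(N) * c ^ L * X ^ (N - 1)`, so a violation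
refutes boundedness. Both tests are complete up to a gap. For the second, if no violation at rate
`c` ever occurred, boundedness at a rate `r ≥ c' > c` would imply boundedness at `q * r` with a
fixed `q < 1`, and iteration would bring the rate below `c'` (`exists_lt_of_not_productsBounded`).

When a test succeeds strictly on the true data, it also succeeds on all sufficiently good
approximations. The approximate products are computed in integers after clearing denominators, and
their errors are majorized by the difference of two nonnegative systems. Every certificate found is
sound for every name of the data, and searching all parameters at increasing precision finds one. -/

namespace SwitchedDelaySystem

variable {n m : ℕ} {D : Finset ℕ}

/-! ### The transition maps -/

section Step

variable {R R' : Type} [CommRing R] [CommRing R']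

/-- The part of an extended state that reaches the actuator after `k` steps. -/
def pend (u : Fin n ⊕ Fin (D.sup id) × Fin m → R) (k : ℕ) (j : Fin m) : R :=
  if h : k < D.sup id then u (Sum.inr (⟨k, h⟩, j)) else 0

/-- The closed-loop transition for the delay `d`, made homogeneous of degree two in the data and
the scale `s`.  The transition of the system itself is obtained for `s = 1`. -/
def step (S : SwitchedDelaySystem n m D R) (s : R) (d : D)
    (u : Fin n ⊕ Fin (D.sup id) × Fin m → R) : Fin n ⊕ Fin (D.sup id) × Fin m → R :=
  Sum.elim
    (fun i => s * (S.A.mulVec fun j => u (Sum.inl j)) i +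
      (S.B.mulVec fun j => s * pend u 0 j + if (d : ℕ) = 0 then (S.K d).mulVec u j else 0) i)
    (fun p => s * s * pend u (p.1 + 1) p.2 +
      if (d : ℕ) = p.1 + 1 then s * (S.K d).mulVec u p.2 else 0)

/-- The transition along a word of delays; the head of the list is the last delay. -/
def run (S : SwitchedDelaySystem n m D R) (s : R) (w : List D)
    (u : Fin n ⊕ Fin (D.sup id) × Fin m → R) : Fin n ⊕ Fin (D.sup id) × Fin m → R :=
  w.foldr (step S s) u

/-- Apply a function to all entries of a system. -/
def map {R R' : Type} (f : R → R') (S : SwitchedDelaySystem n m D R) :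
    SwitchedDelaySystem n m D R' where
  A := S.A.map f
  B := S.B.map f
  K d := (S.K d).map f

theorem map_A_apply {R R' : Type} (f : R → R') (S : SwitchedDelaySystem n m D R) (i j) :
    (S.map f).A i j = f (S.A i j) := rfl

theorem map_B_apply {R R' : Type} (f : R → R') (S : SwitchedDelaySystem n m D R) (i j) :
    (S.map f).B i j = f (S.B i j) := rfl

theorem map_K_apply {R R' : Type} (f : R → R') (S : SwitchedDelaySystem n m D R) (d i j) :
    (S.map f).K d i j = f (S.K d i j) := rfl

@[simp] theorem run_nil (S : SwitchedDelaySystem n m D R) (s : R) (u) : S.run s [] u = u := rfl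

@[simp] theorem run_cons (S : SwitchedDelaySystem n m D R) (s : R) (d : D) (w : List D) (u) :
    S.run s (d :: w) u = S.step s d (S.run s w u) := rfl

theorem map_pend (φ : R →+* R') (u : Fin n ⊕ Fin (D.sup id) × Fin m → R) (k : ℕ) (j : Fin m) :
    φ (pend u k j) = pend (fun i => φ (u i)) k j := by
  unfold pend; split_ifs <;> simp

theorem map_step (φ : R →+* R') (S : SwitchedDelaySystem n m D R) (s : R) (d : D) (u)
    (i : Fin n ⊕ Fin (D.sup id) × Fin m) :
    φ (S.step s d u i) = (S.map φ).step (φ s) d (fun i => φ (u i)) i := by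
  rcases i with i | i
  · simp only [step, Sum.elim_inl, map_add, map_mul, Matrix.mulVec, dotProduct, map_sum, map_pend,
      map, Matrix.map_apply, apply_ite φ, map_zero]
  · simp only [step, Sum.elim_inr, map_add, map_mul, Matrix.mulVec, dotProduct, map_sum, map_pend,
      map, Matrix.map_apply, apply_ite φ, map_zero]

/-- A run is a polynomial expression in the data. Applied to the projections of product rings, this
lets one run carry several systems at once. -/
theorem map_run (φ : R →+* R') (S : SwitchedDelaySystem n m D R) (s : R) (w : List D) (u)
    (i : Fin n ⊕ Fin (D.sup id) × Fin m) :
    φ (S.run s w u i) = (S.map φ).run (φ s) w (fun i => φ (u i)) i := by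
  induction w generalizing i with
  | nil => rfl
  | cons d w ih => simp only [run_cons, map_step, funext ih]

/-- All entries of the system lie in `T`. -/
def EntriesMem (S : SwitchedDelaySystem n m D R) (T : Subsemiring R) : Prop :=
  (∀ i j, S.A i j ∈ T) ∧ (∀ i j, S.B i j ∈ T) ∧ ∀ d i j, S.K d i j ∈ T

theorem pend_mem {T : Subsemiring R} {u : Fin n ⊕ Fin (D.sup id) × Fin m → R} (hu : ∀ i, u i ∈ T)
    (k : ℕ) (j : Fin m) : pend u k j ∈ T := by
  unfold pend; split_ifs
  exacts [hu _, T.zero_mem]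

theorem mulVec_mem {α β : Type} [Fintype β] {T : Subsemiring R} {M : Matrix α β R} {u : β → R}
    (hM : ∀ i j, M i j ∈ T) (hu : ∀ j, u j ∈ T) (i : α) : M.mulVec u i ∈ T := by
  rw [Matrix.mulVec, dotProduct]
  exact sum_mem fun l _ => mul_mem (hM i l) (hu l)

theorem step_mem {T : Subsemiring R} {S : SwitchedDelaySystem n m D R} (hS : S.EntriesMem T)
    {s : R} (hs : s ∈ T) (d : D) {u} (hu : ∀ i, u i ∈ T) (i) : S.step s d u i ∈ T := by
  have hv : ∀ j, (S.K d).mulVec u j ∈ T := mulVec_mem (hS.2.2 d) hu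
  have hite : ∀ (c : Prop) [Decidable c] (r : R), r ∈ T → (if c then r else 0) ∈ T := by
    intro c _ r hr
    split_ifs
    exacts [hr, T.zero_mem]
  rcases i with i | i
  · have hA : (S.A.mulVec fun j => u (Sum.inl j)) i ∈ T :=
      mulVec_mem hS.1 (fun l => hu (Sum.inl l)) i
    have hB : (S.B.mulVec fun j => s * pend u 0 j +
        if (d : ℕ) = 0 then (S.K d).mulVec u j else 0) i ∈ T :=
      mulVec_mem hS.2.1
        (fun _ => add_mem (mul_mem hs (pend_mem hu _ _)) (hite _ _ (hv _))) i
    exact add_mem (mul_mem hs hA) hB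
  · simp only [step, Sum.elim_inr]
    exact add_mem (mul_mem (mul_mem hs hs) (pend_mem hu _ _)) (hite _ _ (mul_mem hs (hv _)))

/-- Transitions use sums and products but no subtraction, so subsemirings suffice. Taking for `T`
the majorized quadruples, or the convergent sequences with their limits, yields error bounds and
continuity of runs. -/
theorem run_mem {T : Subsemiring R} {S : SwitchedDelaySystem n m D R} (hS : S.EntriesMem T)
    {s : R} (hs : s ∈ T) (w : List D) {u} (hu : ∀ i, u i ∈ T) (i) : S.run s w u i ∈ T := by
  induction w generalizing i with
  | nil => exact hu i
  | cons d w ih => exact step_mem hS hs d ih i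

theorem step_add (S : SwitchedDelaySystem n m D R) (s : R) (d : D) (u v) :
    S.step s d (u + v) = S.step s d u + S.step s d v := by
  have hp : ∀ k j, pend (u + v) k j = pend u k j + pend v k j := by
    intro k j; unfold pend; split_ifs <;> simp
  ext (i | p)
  · simp only [step, Sum.elim_inl, Pi.add_apply, hp, Matrix.mulVec, dotProduct,
      mul_add, Finset.sum_add_distrib, ite_add_zero]
    ring
  · simp only [step, Sum.elim_inr, Pi.add_apply, hp, Matrix.mulVec_add, mul_add, ite_add_zero]
    ring

theorem step_smul (S : SwitchedDelaySystem n m D R) (s : R) (d : D) (c : R) (u) :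
    S.step s d (c • u) = c • S.step s d u := by
  have hp : ∀ k j, pend (c • u) k j = c * pend u k j := by
    intro k j; unfold pend; split_ifs <;> simp
  have hi : (fun j => c * u (Sum.inl j)) = c • fun j => u (Sum.inl j) := rfl
  have hB : (fun j => s * (c * pend u 0 j) + if (d : ℕ) = 0 then c * (S.K d).mulVec u j else 0) =
      c • fun j => s * pend u 0 j + if (d : ℕ) = 0 then (S.K d).mulVec u j else 0 := by
    ext j; simp only [Pi.smul_apply, smul_eq_mul]; split_ifs <;> ring
  ext (i | p)
  · simp only [step, Sum.elim_inl, Pi.smul_apply, hp, Matrix.mulVec_smul, smul_eq_mul, hi, hB]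
    ring
  · simp only [step, Sum.elim_inr, Pi.smul_apply, hp, Matrix.mulVec_smul, smul_eq_mul]
    split_ifs <;> ring

/-- The transition as a linear map. -/
def stepLin (S : SwitchedDelaySystem n m D R) (s : R) (d : D) :
    (Fin n ⊕ Fin (D.sup id) × Fin m → R) →ₗ[R] (Fin n ⊕ Fin (D.sup id) × Fin m → R) where
  toFun := S.step s d
  map_add' := S.step_add s d
  map_smul' := S.step_smul s d

/-- The transition matrix of the system for the delay `d`. -/
def trans (S : SwitchedDelaySystem n m D R) (d : D) :
    Matrix (Fin n ⊕ Fin (D.sup id) × Fin m) (Fin n ⊕ Fin (D.sup id) × Fin m) R :=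
  LinearMap.toMatrix' (S.stepLin 1 d)

theorem trans_mulVec (S : SwitchedDelaySystem n m D R) (d : D) (u) :
    (S.trans d).mulVec u = S.step 1 d u := by
  rw [trans, LinearMap.toMatrix'_mulVec]; rfl

theorem run_eq_mulVec (S : SwitchedDelaySystem n m D R) (w : List D) (u) :
    S.run 1 w u = ((w.map S.trans).prod).mulVec u := by
  induction w with
  | nil => simp
  | cons d w ih =>
    rw [run_cons, ih, List.map_cons, List.prod_cons, ← Matrix.mulVec_mulVec, trans_mulVec]

theorem run_single (S : SwitchedDelaySystem n m D R) (w : List D) (i j) :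
    S.run 1 w (Pi.single j 1) i = (w.map S.trans).prod i j := by
  rw [run_eq_mulVec, Matrix.mulVec_single_one]; rfl

/-- This is the homogeneity for which the scale was introduced: with `c = 2 ^ k`, a step on integer
numerators is `4 ^ k` times the step on the dyadic data, whatever the delay. -/
theorem step_map_mul (S : SwitchedDelaySystem n m D R) (c : R) (d : D) (u) :
    (S.map (c * ·)).step c d u = (c * c) • S.step 1 d u := by
  have hA : ∀ (α β : Type) [Fintype β] (M : Matrix α β R) (x : β → R),
      (M.map (c * ·)).mulVec x = c • M.mulVec x := by
    intro α β _ M x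
    rw [← Matrix.smul_mulVec]; rfl
  have hB : (fun j => c * pend u 0 j + if (d : ℕ) = 0 then c * (S.K d).mulVec u j else 0) =
      c • fun j => pend u 0 j + if (d : ℕ) = 0 then (S.K d).mulVec u j else 0 := by
    ext j; simp only [Pi.smul_apply, smul_eq_mul]; split_ifs <;> ring
  ext (i | p)
  · simp only [step, map, Sum.elim_inl, Pi.smul_apply, hA, smul_eq_mul, hB, Matrix.mulVec_smul,
      one_mul]
    ring
  · simp only [step, map, Sum.elim_inr, Pi.smul_apply, hA, smul_eq_mul, one_mul]
    split_ifs <;> ring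

theorem run_map_mul (S : SwitchedDelaySystem n m D R) (c : R) (w : List D) (u) :
    (S.map (c * ·)).run c w u = (c * c) ^ w.length • S.run 1 w u := by
  induction w with
  | nil => simp
  | cons d w ih =>
    rw [run_cons, ih, step_smul, step_map_mul, run_cons, smul_smul, List.length_cons, pow_succ]

end Step

/-! ### Trajectories -/

/-- A signal sent before `t + 1` was sent either before `t` or at `t`. The time `t - max D`, which
leaves the window, contributes nothing because its delay would have to exceed `max D`. -/
theorem pending_add_one (σ : ℤ → D) (v : ℤ → Fin m → ℝ) (t : ℤ) (s : ℕ) :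
    pending σ v (t + 1) s = pending σ v t (s + 1) + if (σ t : ℕ) = s + 1 then v t else 0 := by
  have hsub : ((Finset.Ico (t + 1 - (D.sup id : ℕ)) (t + 1)).filter
      (fun t' => t' + ((σ t' : ℕ) : ℤ) = t + 1 + s)) =
      ((Finset.Ico (t - (D.sup id : ℕ)) t).filter
        (fun t' => t' + ((σ t' : ℕ) : ℤ) = t + (s + 1 : ℕ))) ∪
      (({t} : Finset ℤ).filter (fun t' => (σ t' : ℕ) = s + 1)) := by
    ext a
    have ha : ((σ a : ℕ) : ℤ) ≤ (D.sup id : ℕ) := by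
      exact_mod_cast Finset.le_sup (f := id) (σ a).2
    simp only [Finset.mem_filter, Finset.mem_Ico, Finset.mem_union, Finset.mem_singleton]
    constructor
    · rintro ⟨⟨h1, h2⟩, h3⟩
      by_cases hat : a = t
      · right; subst hat; exact ⟨rfl, by omega⟩
      · left; push_cast; omega
    · rintro (⟨⟨h1, h2⟩, h3⟩ | ⟨rfl, h⟩)
      · push_cast at h3; omega
      · omega
  rw [pending, hsub, Finset.sum_union, pending, Finset.filter_singleton]
  · split_ifs <;> simp
  · rw [Finset.disjoint_left]
    intro a ha hb
    simp only [Finset.mem_filter, Finset.mem_Ico, Finset.mem_singleton] at ha hb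
    omega

theorem pending_of_le (σ : ℤ → D) (v : ℤ → Fin m → ℝ) (t : ℤ) {s : ℕ} (hs : D.sup id ≤ s) :
    pending σ v t s = 0 := by
  rw [pending, Finset.filter_false_of_mem, Finset.sum_empty]
  intro a ha
  have : ((σ a : ℕ) : ℤ) ≤ (D.sup id : ℕ) := by
    exact_mod_cast Finset.le_sup (f := id) (σ a).2
  rw [Finset.mem_Ico] at ha
  omega

theorem plantInput_eq (σ : ℤ → D) (v : ℤ → Fin m → ℝ) (t : ℤ) :
    plantInput σ v t = pending σ v t 0 + if (σ t : ℕ) = 0 then v t else 0 := by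
  have : (Finset.Icc (t - (D.sup id : ℕ)) t) = Finset.Ico (t - (D.sup id : ℕ)) t ∪ {t} := by
    ext a; simp only [Finset.mem_Icc, Finset.mem_union, Finset.mem_Ico, Finset.mem_singleton]
    omega
  rw [plantInput, this, Finset.filter_union, Finset.sum_union, pending, Finset.filter_singleton]
  · split_ifs <;> simp_all
  · rw [Finset.disjoint_left]
    intro a ha hb
    simp only [Finset.mem_filter, Finset.mem_Ico, Finset.mem_singleton] at ha hb
    omega

theorem pend_extState (σ : ℤ → D) (x : ℕ → Fin n → ℝ) (v : ℤ → Fin m → ℝ) (t k : ℕ) (j : Fin m) :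
    pend (extState σ x v t) k j = pending σ v t k j := by
  unfold pend
  split_ifs with h
  · rfl
  · rw [pending_of_le σ v t (not_lt.1 h)]; rfl

theorem extState_add_one (S : SwitchedDelaySystem n m D ℝ) (σ : ℤ → D) (x : ℕ → Fin n → ℝ)
    (v : ℤ → Fin m → ℝ) (t : ℕ)
    (hx : x (t + 1) = S.A.mulVec (x t) + S.B.mulVec (plantInput σ v t))
    (hv : v t = (S.K (σ t)).mulVec (extState σ x v t)) :
    extState σ x v (t + 1) = S.step 1 (σ t) (extState σ x v t) := by
  ext (i | ⟨s, j⟩)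
  · have hB : plantInput σ v t = fun j => 1 * pend (extState σ x v t) 0 j +
        if (σ t : ℕ) = 0 then (S.K (σ t)).mulVec (extState σ x v t) j else 0 := by
      rw [plantInput_eq, ← hv]
      ext j
      simp only [pend_extState, Pi.add_apply, one_mul]
      split_ifs <;> rfl
    simp only [step, Sum.elim_inl, one_mul]
    simp only [one_mul] at hB
    rw [← hB]
    change x (t + 1) i = _
    rw [hx]; rfl
  · simp only [step, Sum.elim_inr, one_mul]
    rw [← hv]
    change pending σ v ((t + 1 : ℕ) : ℤ) s j = _
    rw [pend_extState, Nat.cast_add_one, pending_add_one, Pi.add_apply]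
    split_ifs <;> rfl

/-- The delays at the times `t - 1, …, 0`. -/
def hist {ι : Type*} (σ : ℕ → ι) : ℕ → List ι
  | 0 => []
  | t + 1 => σ t :: hist σ t

@[simp] theorem length_hist {ι : Type*} (σ : ℕ → ι) (t : ℕ) : (hist σ t).length = t := by
  induction t with
  | zero => rfl
  | succ t ih => simp [hist, ih]

theorem Trajectory.extState_eq {S : SwitchedDelaySystem n m D ℝ} (τ : S.Trajectory) (t : ℕ) :
    extState τ.σ τ.x τ.v t =
      S.run 1 (hist (fun t : ℕ => τ.σ t) t) (extState τ.σ τ.x τ.v 0) := by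
  induction t with
  | zero => rfl
  | succ t ih =>
    rw [extState_add_one S _ _ _ _ (τ.plant t) (τ.feedback t), hist, run_cons, ← ih]

/-- Every extended state is an admissible initial condition: if all signals at negative times have
the maximal delay, they arrive one at a time and can be prescribed independently. -/
theorem exists_trajectory (S : SwitchedDelaySystem n m D ℝ) (hD : D.Nonempty) (σ : ℕ → D)
    (u : Fin n ⊕ Fin (D.sup id) × Fin m → ℝ) :
    ∃ τ : S.Trajectory, ∀ t, extState τ.σ τ.x τ.v t = S.run 1 (hist σ t) u := by
  obtain ⟨e, he, hes⟩ : ∃ e ∈ D, D.sup id = e := by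
    obtain ⟨e, he, h⟩ := Finset.exists_mem_eq_sup D hD id
    exact ⟨e, he, h⟩
  let σ' : ℤ → D := fun t => if 0 ≤ t then σ t.toNat else ⟨e, he⟩
  let U : ℕ → Fin n ⊕ Fin (D.sup id) × Fin m → ℝ := fun t => S.run 1 (hist σ t) u
  let x : ℕ → Fin n → ℝ := fun t i => U t (Sum.inl i)
  -- With delay `e = max D`, the signal sent at `s - e` arrives at time `s`, so it must be the
  -- component `u_{s+1}`. Times before `-e` fall outside the window and their values do not matter.
  let v : ℤ → Fin m → ℝ := fun t =>
    if 0 ≤ t then (S.K (σ t.toNat)).mulVec (U t.toNat) else pend u (t + e).toNat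
  have hσ : ∀ t : ℕ, σ' t = σ t := fun t => by simp [σ']
  have hv : ∀ t : ℕ, v t = (S.K (σ t)).mulVec (U t) := fun t => by simp [v]
  have h0 : extState σ' x v 0 = U 0 := by
    ext (i | ⟨s, j⟩)
    · rfl
    · change pending σ' v 0 s j = u (Sum.inr (s, j))
      have hs : (s : ℕ) < e := hes ▸ s.2
      rw [pending, Finset.sum_eq_single_of_mem ((s : ℤ) - e)]
      · have : ¬ (0 : ℤ) ≤ (s : ℤ) - e := by omega
        simp only [v, if_neg this]
        unfold pend
        have h2 : ((s : ℤ) - e + e).toNat = s := by omega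
        rw [dif_pos (by rw [h2]; exact s.2)]
        congr 3
        exact Fin.ext h2
      · have : ¬ (0 : ℤ) ≤ (s : ℤ) - e := by omega
        simp only [Finset.mem_filter, Finset.mem_Ico, σ', if_neg this, hes]
        omega
      · intro b hb hne
        simp only [Finset.mem_filter, Finset.mem_Ico] at hb
        have hb0 : ¬ (0 : ℤ) ≤ b := by omega
        simp only [σ', if_neg hb0] at hb
        omega
  have hplant : ∀ t : ℕ, extState σ' x v t = U t →
      x (t + 1) = S.A.mulVec (x t) + S.B.mulVec (plantInput σ' v t) := by
    intro t ht
    have hB : plantInput σ' v t = fun j => pend (U t) 0 j +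
        if (σ t : ℕ) = 0 then (S.K (σ t)).mulVec (U t) j else 0 := by
      rw [plantInput_eq, hv, hσ]
      ext j
      rw [← ht]
      simp only [pend_extState, Pi.add_apply]
      split_ifs <;> rfl
    rw [hB]
    ext i
    change S.step 1 (σ t) (U t) (Sum.inl i) = _
    simp only [step, Sum.elim_inl, one_mul]
    rfl
  have hall : ∀ t : ℕ, extState σ' x v t = U t := by
    intro t
    induction t with
    | zero => exact h0
    | succ t ih =>
      rw [extState_add_one S σ' x v t (hplant t ih) (by rw [hv, hσ, ih]), ih, hσ]
      rfl
  exact ⟨⟨σ', x, v, fun t => hplant t (hall t), fun t => by rw [hv, hσ, hall]⟩, hall⟩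

end SwitchedDelaySystem

/-! ### An inequality of Bochi type -/

section Bochi

variable {ι κ : Type*} [Fintype ι]

theorem abs_mul_apply_le {X Y : Matrix ι ι ℝ} {a b : ℝ} (hX : ∀ i j, |X i j| ≤ a)
    (hY : ∀ i j, |Y i j| ≤ b) (i j : ι) : |(X * Y) i j| ≤ Fintype.card ι * (a * b) := by
  rw [Matrix.mul_apply]
  refine (Finset.abs_sum_le_sum_abs _ _).trans ?_
  refine (Finset.sum_le_card_nsmul _ _ (a * b) fun k _ => ?_).trans (by simp)
  rw [abs_mul]
  exact mul_le_mul (hX i k) (hY k j) (abs_nonneg _) ((abs_nonneg _).trans (hX i k))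

theorem norm_mulVec_le {P : Matrix ι ι ℝ} {a : ℝ} (hP : ∀ i j, |P i j| ≤ a) (u : ι → ℝ) :
    ‖P.mulVec u‖ ≤ Fintype.card ι * a * ‖u‖ := by
  rcases isEmpty_or_nonempty ι with hι | ⟨⟨i0⟩⟩
  · simp [Subsingleton.elim (P.mulVec u) 0]
  have ha : 0 ≤ a := (abs_nonneg _).trans (hP i0 i0)
  refine (pi_norm_le_iff_of_nonneg (by positivity)).2 fun i => ?_
  rw [Matrix.mulVec, dotProduct]
  refine (norm_sum_le _ _).trans ?_
  refine (Finset.sum_le_card_nsmul _ _ (a * ‖u‖) fun k _ => ?_).trans (le_of_eq (by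
    rw [Finset.card_univ, nsmul_eq_mul, mul_assoc]))
  rw [norm_mul]
  exact mul_le_mul (hP i k) (norm_le_pi_norm u k) (norm_nonneg _) ha

variable [DecidableEq ι]

theorem abs_list_prod_apply_le {b : ℝ} (l : List (Matrix ι ι ℝ))
    (hl : ∀ B ∈ l, ∀ i j, |B i j| ≤ b) (i j : ι) :
    |l.prod i j| ≤ (Fintype.card ι * b) ^ l.length := by
  induction l generalizing i j with
  | nil =>
    rw [List.prod_nil, Matrix.one_apply]
    split_ifs <;> simp
  | cons B l ih =>
    rw [List.prod_cons, List.length_cons, pow_succ']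
    refine (abs_mul_apply_le (hl B (by simp)) (ih fun B' h => hl B' (by simp [h])) i j).trans
      (le_of_eq (by ring))

/-- Expand the product over paths of indices starting at `i`. The rank `h` cannot drop strictly at
all `l.length + 1` steps when `h i ≤ l.length`, so each path has a step where it does not drop, and
that factor is at most `r` instead of `b`. -/
theorem abs_list_prod_apply_le_of_rank {b r : ℝ} (h : ι → ℕ) (B : Matrix ι ι ℝ)
    (l : List (Matrix ι ι ℝ)) (hl : ∀ B' ∈ B :: l, ∀ i j, |B' i j| ≤ b)
    (hr : ∀ B' ∈ B :: l, ∀ i j, h i ≤ h j → |B' i j| ≤ r) (i j : ι) (hi : h i ≤ l.length) :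
    |(B :: l).prod i j| ≤ Fintype.card ι * r * (Fintype.card ι * b) ^ l.length := by
  have hb : 0 ≤ b := (abs_nonneg _).trans (hl B (by simp) i i)
  have hr0 : 0 ≤ r := (abs_nonneg _).trans (hr B (by simp) i i le_rfl)
  induction l generalizing B i j with
  | nil =>
    have hN : (1 : ℝ) ≤ Fintype.card ι := by
      exact_mod_cast Fintype.card_pos_iff.2 ⟨i⟩
    rw [List.prod_singleton, List.length_nil, pow_zero, mul_one]
    have : h i ≤ h j := by simp only [List.length_nil] at hi; omega
    exact (hr B (by simp) i j this).trans (le_mul_of_one_le_left hr0 hN)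
  | cons B' l ih =>
    rw [List.prod_cons, Matrix.mul_apply]
    refine (Finset.abs_sum_le_sum_abs _ _).trans ?_
    refine (Finset.sum_le_card_nsmul _ _ (r * (Fintype.card ι * b) ^ (l.length + 1))
      fun k _ => ?_).trans (le_of_eq (by
        rw [Finset.card_univ, nsmul_eq_mul, List.length_cons]; ring))
    rw [abs_mul]
    by_cases hk : h i ≤ h k
    · refine mul_le_mul (hr B (by simp) i k hk) ?_ (abs_nonneg _) hr0
      exact abs_list_prod_apply_le (B' :: l) (fun B'' h => hl B'' (by simp [h])) k j
    · have := ih B' (fun B'' h => hl B'' (by simp [h]))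
        (fun B'' h => hr B'' (by simp [h])) k j (by simp only [List.length_cons] at hi; omega)
      refine (mul_le_mul (hl B (by simp) i k) this (abs_nonneg _) hb).trans (le_of_eq ?_)
      ring

/-- Diagonalize `F * Fᵀ` by an orthogonal `O`. The rows of `Oᵀ * F` are then orthogonal with lengths
`μ i`, and normalizing them gives `Y`. -/
theorem exists_singular_value_decomposition (F : Matrix ι ι ℝ) (hF : F.det ≠ 0) :
    ∃ (O Y : Matrix ι ι ℝ) (μ : ι → ℝ), (∀ i, 0 < μ i) ∧ (∀ i j, |O i j| ≤ 1) ∧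
      (∀ i j, |Y i j| ≤ 1) ∧ O * O.transpose = 1 ∧ O.transpose * O = 1 ∧ Y * Y.transpose = 1 ∧
      F = O * Matrix.diagonal μ * Y := by
  have hA : (F * F.transpose).IsHermitian := by
    rw [← Matrix.conjTranspose_eq_transpose_of_trivial]
    exact Matrix.isHermitian_mul_conjTranspose_self F
  set O : Matrix ι ι ℝ := hA.eigenvectorUnitary.1 with hO
  have hOO : O * O.transpose = 1 := by
    have := Unitary.mul_star_self_of_mem hA.eigenvectorUnitary.2
    rwa [Matrix.star_eq_conjTranspose, Matrix.conjTranspose_eq_transpose_of_trivial] at this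
  have hOO' : O.transpose * O = 1 := mul_eq_one_comm.1 hOO
  have hsp : F * F.transpose = O * Matrix.diagonal hA.eigenvalues * O.transpose := by
    have := hA.spectral_theorem
    rw [Unitary.conjStarAlgAut_apply, Matrix.star_eq_conjTranspose,
      Matrix.conjTranspose_eq_transpose_of_trivial] at this
    exact this
  set G := O.transpose * F with hG
  have hGG : G * G.transpose = Matrix.diagonal hA.eigenvalues := by
    calc G * G.transpose = O.transpose * (F * F.transpose) * O := by
          rw [hG, Matrix.transpose_mul, Matrix.transpose_transpose]
          simp only [Matrix.mul_assoc]
      _ = O.transpose * (O * Matrix.diagonal hA.eigenvalues * O.transpose) * O :=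
          congrArg (fun M => O.transpose * M * O) hsp
      _ = (O.transpose * O) * Matrix.diagonal hA.eigenvalues * (O.transpose * O) := by
          simp only [Matrix.mul_assoc]
      _ = _ := by rw [hOO', Matrix.one_mul, Matrix.mul_one]
  have hdet : (G * G.transpose).det ≠ 0 := by
    have h1 : O.det ≠ 0 := by
      intro h0
      have := congrArg Matrix.det hOO
      rw [Matrix.det_mul, h0, zero_mul, Matrix.det_one] at this
      exact zero_ne_one this
    rw [Matrix.det_mul, Matrix.det_transpose, hG, Matrix.det_mul, Matrix.det_transpose]
    positivity
  have hpos : ∀ i, 0 < hA.eigenvalues i := by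
    intro i
    refine lt_of_le_of_ne ?_ ?_
    · have := congrFun (congrFun hGG i) i
      rw [Matrix.diagonal_apply_eq, Matrix.mul_apply] at this
      rw [← this]
      exact Finset.sum_nonneg fun k _ => mul_self_nonneg (G i k)
    · intro h0
      rw [hGG, Matrix.det_diagonal] at hdet
      exact hdet (Finset.prod_eq_zero (Finset.mem_univ i) h0.symm)
  set μ : ι → ℝ := fun i => √(hA.eigenvalues i) with hμ
  have hμ0 : ∀ i, 0 < μ i := fun i => Real.sqrt_pos.2 (hpos i)
  set Y := Matrix.diagonal (fun i => (μ i)⁻¹) * G with hY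
  have hYY : Y * Y.transpose = 1 := by
    rw [hY, Matrix.transpose_mul, Matrix.diagonal_transpose, Matrix.mul_assoc,
      ← Matrix.mul_assoc G, hGG, Matrix.diagonal_mul_diagonal, Matrix.diagonal_mul_diagonal,
      ← Matrix.diagonal_one]
    congr 1
    ext i
    have h1 : hA.eigenvalues i = μ i * μ i := (Real.mul_self_sqrt (hpos i).le).symm
    have h2 := (hμ0 i).ne'
    rw [h1]; field_simp
  have hentry : ∀ U : Matrix ι ι ℝ, U * U.transpose = 1 → ∀ i j, |U i j| ≤ 1 := by
    intro U hU i j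
    have hU' : U ∈ Matrix.unitaryGroup ι ℝ := by
      rw [Matrix.mem_unitaryGroup_iff, Matrix.star_eq_conjTranspose,
        Matrix.conjTranspose_eq_transpose_of_trivial, hU]
    exact entry_norm_bound_of_unitary hU' i j
  refine ⟨O, Y, μ, hμ0, hentry O hOO, hentry Y hYY, hOO, hOO', hYY, ?_⟩
  have hone : Matrix.diagonal μ * Matrix.diagonal (fun i => (μ i)⁻¹) = 1 := by
    rw [Matrix.diagonal_mul_diagonal, ← Matrix.diagonal_one]
    congr 1
    ext i
    exact mul_inv_cancel₀ (hμ0 i).ne'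
  rw [hY, Matrix.mul_assoc, ← Matrix.mul_assoc (Matrix.diagonal μ), hone, Matrix.one_mul, hG,
    ← Matrix.mul_assoc, hOO, Matrix.one_mul]

/-- If the products of the matrices `T k` grow at most like `r ^ length`, then there is a basis in
which every product of length `l` has entries at most `r ^ l`. -/
theorem exists_adapted_basis (T : κ → Matrix ι ι ℝ) {r C : ℝ} (hr : 0 < r)
    (hC : ∀ (w : List κ) i j, |(w.map T).prod i j| ≤ C * r ^ w.length) :
    ∃ F : Matrix ι ι ℝ, F.det ≠ 0 ∧ ∀ w : List κ, ∃ Z : Matrix ι ι ℝ,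
      (w.map T).prod * F = F * Z ∧ ∀ i j, |Z i j| ≤ r ^ w.length := by
  -- `K` is the unit ball of the norm given by the supremum over `w` of `|T_w x| / r ^ |w|`, in
  -- which every `T k` has norm at most `r`. The empty word makes it bounded, and the growth
  -- hypothesis puts small multiples of the unit vectors into it.
  set K : Set (ι → ℝ) := {x | ∀ (w : List κ) i, |((w.map T).prod.mulVec x) i| ≤ r ^ w.length}
    with hK
  have hKclosed : IsClosed K := by
    simp only [hK, Set.ofPred_forall]
    refine isClosed_iInter fun w => isClosed_iInter fun i => isClosed_le ?_ continuous_const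
    exact ((continuous_apply i).comp (Continuous.matrix_mulVec continuous_const continuous_id)).abs
  have hKcompact : IsCompact K := by
    refine (isCompact_univ_pi fun _ : ι => isCompact_Icc (a := (-1 : ℝ)) (b := 1)).of_isClosed_subset
      hKclosed fun x hx i _ => ?_
    have := hx [] i
    simp only [List.map_nil, List.prod_nil, Matrix.one_mulVec, List.length_nil, pow_zero] at this
    exact abs_le.1 this
  set δ : ℝ := (max C 1)⁻¹ with hδ
  have hδ0 : 0 < δ := inv_pos.2 (lt_max_of_lt_right one_pos)
  have hmem : (fun j : ι => δ • (Pi.single j 1 : ι → ℝ)) ∈ Set.pi Set.univ fun _ : ι => K := by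
    intro j _ w i
    rw [Matrix.mulVec_smul, Matrix.mulVec_single_one, Pi.smul_apply, smul_eq_mul, abs_mul,
      abs_of_pos hδ0]
    calc δ * |(w.map T).prod i j| ≤ δ * (max C 1 * r ^ w.length) := by
          gcongr
          exact (hC w i j).trans (by gcongr; exact le_max_left _ _)
      _ = r ^ w.length := by
          rw [← mul_assoc, hδ, inv_mul_cancel₀ (lt_max_of_lt_right one_pos).ne', one_mul]
  have hdetc : Continuous fun f : ι → ι → ℝ => |(Matrix.of f).det| :=
    (Continuous.matrix_det (A := fun f : ι → ι → ℝ => Matrix.of f) continuous_id).abs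
  -- An Auerbach basis: vectors of `K` with maximal determinant. By Cramer's rule every element of
  -- `K` has coordinates of absolute value at most 1 in it.
  obtain ⟨f, hf, hmax⟩ := (isCompact_univ_pi fun _ : ι => hKcompact).exists_isMaxOn ⟨_, hmem⟩
    hdetc.continuousOn
  have hfK : ∀ j, f j ∈ K := fun j => hf j trivial
  have hdet : (Matrix.of f).det ≠ 0 := by
    have h1 := hmax hmem
    have h2 : (Matrix.of fun j : ι => δ • (Pi.single j 1 : ι → ℝ)) = δ • (1 : Matrix ι ι ℝ) := by
      ext i j
      simp [Matrix.one_apply, Pi.single_apply, eq_comm]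
    simp only [Set.mem_ofPred_eq, h2, Matrix.det_smul, Matrix.det_one, mul_one] at h1
    intro h0
    rw [h0, abs_zero] at h1
    exact absurd h1 (not_le.2 (abs_pos.2 (pow_ne_zero _ hδ0.ne')))
  have hcr : ∀ x ∈ K, ∀ i, |((Matrix.of f).updateRow i x).det| ≤ |(Matrix.of f).det| := by
    intro x hx i
    refine hmax (a := Function.update f i x) fun j _ => ?_
    by_cases hj : j = i
    · subst hj; simpa using hx
    · simpa [Function.update_of_ne hj] using hfK j
  refine ⟨(Matrix.of f).transpose, by rwa [Matrix.det_transpose], fun w => ?_⟩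
  set x : ι → ι → ℝ := fun j => (w.map T).prod.mulVec (f j) with hx
  -- The rescaled products leave `K` invariant: bounds for the words `w' ++ w` at `f j` are bounds
  -- for `w'` at `x j`.
  have hxK : ∀ j, (r ^ w.length)⁻¹ • x j ∈ K := by
    intro j w' i
    have h1 := hfK j (w' ++ w) i
    rw [List.map_append, List.prod_append, ← Matrix.mulVec_mulVec, List.length_append,
      pow_add] at h1
    rw [Matrix.mulVec_smul, Pi.smul_apply, smul_eq_mul, abs_mul, abs_of_pos (by positivity),
      inv_mul_le_iff₀ (by positivity), mul_comm]
    exact h1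
  refine ⟨Matrix.of fun i j => ((Matrix.of f).det)⁻¹ * (Matrix.of f).transpose.cramer (x j) i,
    ?_, fun i j => ?_⟩
  · ext i j
    have h1 := congrFun (Matrix.mulVec_cramer (Matrix.of f).transpose (x j)) i
    rw [Pi.smul_apply, smul_eq_mul, Matrix.det_transpose] at h1
    have h2 : ((w.map T).prod * (Matrix.of f).transpose) i j = x j i := rfl
    have h3 : ((Matrix.of f).transpose * Matrix.of fun i j =>
        ((Matrix.of f).det)⁻¹ * (Matrix.of f).transpose.cramer (x j) i) i j =
        ((Matrix.of f).det)⁻¹ *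
          ((Matrix.of f).transpose.mulVec ((Matrix.of f).transpose.cramer (x j))) i := by
      simp only [Matrix.mul_apply, Matrix.mulVec, dotProduct, Finset.mul_sum, Matrix.of_apply]
      exact Finset.sum_congr rfl fun k _ => by ring
    rw [h2, h3, h1, inv_mul_cancel_left₀ hdet]
  · rw [Matrix.of_apply, Matrix.cramer_transpose_apply]
    have h1 := hcr _ (hxK j) i
    rw [Matrix.det_updateRow_smul, abs_mul, abs_of_pos (by positivity),
      inv_mul_le_iff₀ (by positivity)] at h1
    rw [abs_mul, abs_inv, inv_mul_le_iff₀ (abs_pos.2 hdet)]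
    linarith

theorem exists_flatten_eq (L : ℕ) (k : ℕ) (w : List κ) (hw : w.length = k * L) :
    ∃ ls : List (List κ), ls.length = k ∧ (∀ l ∈ ls, l.length = L) ∧ ls.flatten = w := by
  induction k generalizing w with
  | zero => exact ⟨[], rfl, by simp, by simpa [eq_comm] using hw⟩
  | succ k ih =>
    have hw' : w.length = k * L + L := by rw [hw]; ring
    obtain ⟨ls, h1, h2, h3⟩ := ih (w.drop L) (by rw [List.length_drop]; omega)
    refine ⟨w.take L :: ls, by simp [h1], ?_, by simp [h3]⟩
    intro l hl
    rcases List.mem_cons.1 hl with rfl | hl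
    · rw [List.length_take]; omega
    · exact h2 l hl

theorem list_prod_conj {O : Matrix ι ι ℝ} (hO : O * O.transpose = 1)
    (hO' : O.transpose * O = 1) (l : List (Matrix ι ι ℝ)) :
    (l.map fun B => O.transpose * B * O).prod = O.transpose * l.prod * O := by
  induction l with
  | nil => simp [hO']
  | cons B l ih =>
    rw [List.map_cons, List.prod_cons, ih, List.prod_cons]
    calc O.transpose * B * O * (O.transpose * l.prod * O)
        = O.transpose * B * (O * O.transpose) * l.prod * O := by simp only [Matrix.mul_assoc]
      _ = O.transpose * (B * l.prod) * O := by
        rw [hO, Matrix.mul_one]; simp only [Matrix.mul_assoc]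

/-- The constant of the inequality `abs_prod_le_of_bounded`. -/
def bochiConst (N : ℕ) : ℕ := N ^ 5 * (N ^ 3) ^ (N - 1)

/-- If the products of the matrices `T k` grow at most like `r ^ length`, and the products of length
`L` have entries at most `X`, then the products of `N` blocks of length `L`, with `N` the dimension,
are bounded by a multiple of `r ^ L * X ^ (N - 1)` that depends on `N` only. -/
theorem abs_prod_le_of_bounded (T : κ → Matrix ι ι ℝ) {r C X : ℝ} (hr : 0 < r)
    (hC : ∀ (w : List κ) i j, |(w.map T).prod i j| ≤ C * r ^ w.length) (L : ℕ)
    (hX : ∀ w : List κ, w.length = L → ∀ i j, |(w.map T).prod i j| ≤ X)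
    (w : List κ) (hw : w.length = Fintype.card ι * L) (i j : ι) :
    |(w.map T).prod i j| ≤
      bochiConst (Fintype.card ι) * r ^ L * X ^ (Fintype.card ι - 1) := by
  obtain ⟨F, hF, hZ⟩ := exists_adapted_basis T hr hC
  obtain ⟨O, Y, μ, hμ, hO1, hY1, hOO, hOO', hYY, hFO⟩ := exists_singular_value_decomposition F hF
  set N := Fintype.card ι with hN
  have hN1 : 0 < N := Fintype.card_pos_iff.2 ⟨i⟩
  have hOt : ∀ i j, |O.transpose i j| ≤ 1 := fun i j => hO1 j i
  have hYt : ∀ i j, |Y.transpose i j| ≤ 1 := fun i j => hY1 j i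
  have hconj : ∀ (U V B : Matrix ι ι ℝ) (b : ℝ), (∀ i j, |U i j| ≤ 1) → (∀ i j, |V i j| ≤ 1) →
      (∀ i j, |B i j| ≤ b) → ∀ i j, |(U * B * V) i j| ≤ N ^ 2 * b := by
    intro U V B b hU hV hB i j
    refine (abs_mul_apply_le (abs_mul_apply_le hU hB) hV i j).trans (le_of_eq ?_)
    rw [← hN]; ring
  obtain ⟨ls, hls, hlsL, hflat⟩ := exists_flatten_eq L N w hw
  set l : List (Matrix ι ι ℝ) := ls.map fun l => (l.map T).prod with hl
  have hprod : (w.map T).prod = l.prod := by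
    rw [← hflat, List.map_flatten, List.prod_flatten, List.map_map]; rfl
  -- The rank of a singular value takes values below `N`, so a product of `N` factors is long enough
  -- for the path argument.
  set h : ι → ℕ := fun i => (Finset.univ.filter fun k => μ k < μ i).card with hh
  have hrank : ∀ i j, h i ≤ h j → μ i ≤ μ j := by
    intro i j hij
    by_contra hlt
    rw [not_le] at hlt
    refine absurd hij (not_le.2 (Finset.card_lt_card ?_))
    rw [Finset.ssubset_iff_of_subset]
    · exact ⟨j, by simpa using hlt, by simp⟩
    · intro k hk
      simp only [Finset.mem_filter, Finset.mem_univ, true_and] at hk ⊢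
      exact hk.trans hlt
  have hhi : ∀ i, h i < N := fun i =>
    Finset.card_lt_univ_of_notMem (x := i) (by simp)
  -- The blocks are conjugated by the orthogonal `O` rather than by `F`, which may be badly
  -- conditioned. This keeps the bound `X` up to the factor `N ^ 2`.
  set lt : List (Matrix ι ι ℝ) := l.map fun B => O.transpose * B * O with hlt
  have hltb : ∀ B ∈ lt, ∀ i j, |B i j| ≤ N ^ 2 * X := by
    intro B hB
    obtain ⟨B', hB', rfl⟩ := List.mem_map.1 hB
    obtain ⟨w', hw', rfl⟩ := List.mem_map.1 hB'
    exact hconj _ _ _ _ hOt hO1 (hX w' (hlsL w' hw'))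
  have hltr : ∀ B ∈ lt, ∀ i j, h i ≤ h j → |B i j| ≤ N ^ 2 * r ^ L := by
    intro B hB i j hij
    obtain ⟨B', hB', rfl⟩ := List.mem_map.1 hB
    obtain ⟨w', hw', rfl⟩ := List.mem_map.1 hB'
    obtain ⟨Z, hZ1, hZ2⟩ := hZ w'
    rw [hlsL w' hw'] at hZ2
    -- The entry `(i, j)` of the conjugated block is `μ i / μ j` times an entry of `Y * Z * Yᵀ`,
    -- hence at most `N ^ 2 * r ^ L` whenever `μ i ≤ μ j`.
    have hkey : O.transpose * (w'.map T).prod * O * Matrix.diagonal μ =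
        Matrix.diagonal μ * (Y * Z * Y.transpose) := by
      calc O.transpose * (w'.map T).prod * O * Matrix.diagonal μ
          = O.transpose * ((w'.map T).prod * (O * Matrix.diagonal μ * Y)) * Y.transpose := by
            simp only [Matrix.mul_assoc, hYY, Matrix.mul_one]
        _ = O.transpose * (O * Matrix.diagonal μ * Y * Z) * Y.transpose := by
            rw [← hFO, hZ1]
        _ = (O.transpose * O) * Matrix.diagonal μ * (Y * Z * Y.transpose) := by
            simp only [Matrix.mul_assoc]
        _ = _ := by rw [hOO', Matrix.one_mul]
    have h1 := congrFun (congrFun hkey i) j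
    rw [Matrix.mul_diagonal, Matrix.diagonal_mul] at h1
    have h2 := hconj Y Y.transpose Z _ hY1 hYt hZ2 i j
    have h3 : |(O.transpose * (w'.map T).prod * O) i j| * μ j =
        μ i * |(Y * Z * Y.transpose) i j| := by
      rw [← abs_of_pos (hμ j), ← abs_mul, h1, abs_mul, abs_of_pos (hμ i)]
    have h4 := hrank i j hij
    have h5 : |(O.transpose * (w'.map T).prod * O) i j| * μ j ≤ (N ^ 2 * r ^ L) * μ j := by
      rw [h3, mul_comm]
      exact mul_le_mul h2 h4 (hμ i).le (by positivity)
    exact le_of_mul_le_mul_right h5 (hμ j)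
  have hltlen : lt.length = N := by rw [hlt, hl, List.length_map, List.length_map, hls]
  have hmain : ∀ i j, |lt.prod i j| ≤ N * (N ^ 2 * r ^ L) * (N * (N ^ 2 * X)) ^ (N - 1) := by
    intro i j
    rcases hc : lt with _ | ⟨B, l'⟩
    · rw [hc, List.length_nil] at hltlen; omega
    · rw [hc] at hltb hltr hltlen
      rw [List.length_cons] at hltlen
      have hl' : l'.length = N - 1 := by omega
      have := abs_list_prod_apply_le_of_rank h B l' hltb hltr i j (by have := hhi i; omega)
      rw [hl'] at this
      exact this
  have hback : l.prod = O * lt.prod * O.transpose := by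
    rw [hlt, list_prod_conj hOO hOO']
    calc l.prod = (O * O.transpose) * l.prod * (O * O.transpose) := by
          rw [hOO, Matrix.one_mul, Matrix.mul_one]
      _ = _ := by simp only [Matrix.mul_assoc]
  rw [hprod, hback]
  -- Undoing the conjugation costs another `N ^ 2`. Together with the `N * N ^ 2` in front of `r ^
  -- L` this is the factor `N ^ 5` of `bochiConst`.
  refine (hconj _ _ _ _ hO1 hOt hmain i j).trans (le_of_eq ?_)
  rw [bochiConst]
  push_cast
  have : (N : ℝ) * (N ^ 2 * X) = N ^ 3 * X := by ring
  rw [this, mul_pow]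
  ring

end Bochi

/-! ### Growth of matrix products -/

section Products

variable {ι κ : Type*} [Fintype ι] [DecidableEq ι]

/-- The products of the matrices `T k` grow at most like `c ^ length`. -/
def ProductsBounded (T : κ → Matrix ι ι ℝ) (c : ℝ) : Prop :=
  ∃ C : ℝ, ∀ (w : List κ) i j, |(w.map T).prod i j| ≤ C * c ^ w.length

/-- `X` bounds all entries of all products of `L` of the matrices `T k`. -/
def EntriesBounded (T : κ → Matrix ι ι ℝ) (L : ℕ) (X : ℝ) : Prop :=
  ∀ w : List κ, w.length = L → ∀ i j, |(w.map T).prod i j| ≤ X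

theorem eventually_mul_pow_lt {y z : ℝ} (hy : 0 ≤ y) (hyz : y < z) (A : ℝ) :
    ∀ᶠ L : ℕ in Filter.atTop, A * y ^ L < z ^ L := by
  have hz : 0 < z := hy.trans_lt hyz
  have h := (tendsto_pow_atTop_nhds_zero_of_lt_one (div_nonneg hy hz.le)
    ((div_lt_one hz).2 hyz)).const_mul A
  rw [mul_zero] at h
  filter_upwards [h.eventually_lt_const one_pos] with L hL
  rw [div_pow, ← mul_div_assoc, div_lt_one (by positivity)] at hL
  exact hL

theorem ProductsBounded.exists_nonneg {T : κ → Matrix ι ι ℝ} {c : ℝ} (h : ProductsBounded T c)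
    (hc : 0 ≤ c) :
    ∃ C : ℝ, 0 ≤ C ∧ ∀ (w : List κ) i j, |(w.map T).prod i j| ≤ C * c ^ w.length := by
  obtain ⟨C, hC⟩ := h
  exact ⟨max C 0, le_max_right _ _, fun w i j => (hC w i j).trans
    (mul_le_mul_of_nonneg_right (le_max_left _ _) (by positivity))⟩

theorem ProductsBounded.mono {T : κ → Matrix ι ι ℝ} {c c' : ℝ} (h : ProductsBounded T c)
    (hc : 0 ≤ c) (hcc : c ≤ c') : ProductsBounded T c' := by
  obtain ⟨C, hC0, hC⟩ := h.exists_nonneg hc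
  exact ⟨C, fun w i j => (hC w i j).trans
    (mul_le_mul_of_nonneg_left (pow_le_pow_left₀ hc hcc _) hC0)⟩

theorem exists_abs_list_prod_le [Finite κ] (T : κ → Matrix ι ι ℝ) :
    ∃ b : ℝ, 0 < b ∧ ∀ (w : List κ) i j, |(w.map T).prod i j| ≤ b ^ w.length := by
  have := Fintype.ofFinite κ
  set b : ℝ := ∑ k, ∑ i, ∑ j, |T k i j| with hb
  have hle : ∀ k i j, |T k i j| ≤ b := by
    intro k i j
    have h1 : |T k i j| ≤ ∑ j, |T k i j| :=
      Finset.single_le_sum (f := fun j => |T k i j|) (fun _ _ => abs_nonneg _) (Finset.mem_univ j)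
    have h2 : ∑ j, |T k i j| ≤ ∑ i, ∑ j, |T k i j| :=
      Finset.single_le_sum (f := fun i => ∑ j, |T k i j|)
        (fun _ _ => Finset.sum_nonneg fun _ _ => abs_nonneg _) (Finset.mem_univ i)
    have h3 : ∑ i, ∑ j, |T k i j| ≤ b :=
      Finset.single_le_sum (f := fun k => ∑ i, ∑ j, |T k i j|)
        (fun _ _ => Finset.sum_nonneg fun _ _ => Finset.sum_nonneg fun _ _ => abs_nonneg _)
        (Finset.mem_univ k)
    exact h1.trans (h2.trans h3)
  have hb0 : 0 ≤ b := Finset.sum_nonneg fun _ _ => Finset.sum_nonneg fun _ _ =>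
    Finset.sum_nonneg fun _ _ => abs_nonneg _
  refine ⟨Fintype.card ι * b + 1, by positivity, fun w i j => ?_⟩
  refine (abs_list_prod_apply_le (b := b) (w.map T) ?_ i j).trans ?_
  · intro B hB
    obtain ⟨k, _, rfl⟩ := List.mem_map.1 hB
    exact hle k
  · rw [List.length_map]
    exact pow_le_pow_left₀ (by positivity) (by linarith) _

theorem pow_le_max_pow_mul {b c : ℝ} (hb : 0 < b) (hc : 0 < c) {l L : ℕ} (hl : l ≤ L) :
    b ^ l ≤ max 1 (b / c) ^ L * c ^ l := by
  calc b ^ l = (b / c) ^ l * c ^ l := by rw [← mul_pow, div_mul_cancel₀ _ hc.ne']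
    _ ≤ max 1 (b / c) ^ l * c ^ l := by gcongr; exact le_max_right _ _
    _ ≤ max 1 (b / c) ^ L * c ^ l := by gcongr; exact le_max_left _ _

/-- Each block of length `L` split off a word multiplies the bound by `N * X ≤ c ^ L`. The remainder
is shorter than `L`, and the constant absorbs it. -/
theorem EntriesBounded.productsBounded [Finite κ] {T : κ → Matrix ι ι ℝ} {L : ℕ} {X c : ℝ}
    (h : EntriesBounded T L X) (hL : 0 < L) (hc : 0 < c) (hX : Fintype.card ι * X ≤ c ^ L) :
    ProductsBounded T c := by
  obtain ⟨b, hb, hbw⟩ := exists_abs_list_prod_le T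
  refine ⟨max 1 (b / c) ^ L, fun w => ?_⟩
  induction hn : w.length using Nat.strong_induction_on generalizing w with
  | _ l ih =>
    intro i j
    by_cases hlL : l < L
    · rw [← hn] at hlL ⊢
      exact (hbw w i j).trans (pow_le_max_pow_mul hb hc hlL.le)
    · have hw : (w.map T).prod = ((w.take L).map T).prod * ((w.drop L).map T).prod := by
        rw [← List.prod_append, ← List.map_append, List.take_append_drop]
      have h1 := h (w.take L) (by rw [List.length_take]; omega)
      have h2 := ih (l - L) (by omega) (w.drop L) (by rw [List.length_drop, hn])
      rw [hw]
      refine (abs_mul_apply_le h1 h2 i j).trans ?_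
      have hl : c ^ l = c ^ L * c ^ (l - L) := by rw [← pow_add]; congr 1; omega
      rw [hl]
      calc Fintype.card ι * (X * (max 1 (b / c) ^ L * c ^ (l - L)))
          = (Fintype.card ι * X) * (max 1 (b / c) ^ L * c ^ (l - L)) := by ring
        _ ≤ c ^ L * (max 1 (b / c) ^ L * c ^ (l - L)) := by gcongr
        _ = _ := by ring

theorem not_productsBounded_of_lt {T : κ → Matrix ι ι ℝ} {L : ℕ} {X c : ℝ}
    (h : EntriesBounded T L X) (hc : 0 < c) {w : List κ} (hw : w.length = Fintype.card ι * L)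
    {i j : ι} (hlt : bochiConst (Fintype.card ι) * c ^ L * X ^ (Fintype.card ι - 1) <
      |(w.map T).prod i j|) : ¬ ProductsBounded T c := fun ⟨_, hC⟩ =>
  not_le.2 hlt (abs_prod_le_of_bounded T hc hC L h w hw i j)

/-- Completeness of the upper test: since `r < c`, the power `c ^ L` eventually exceeds `N * C * r ^
L`. Strictness leaves room for approximation errors. -/
theorem ProductsBounded.exists_entriesBounded {T : κ → Matrix ι ι ℝ} {r c : ℝ}
    (h : ProductsBounded T r) (hr : 0 ≤ r) (hrc : r < c) :
    ∃ L > 0, ∃ X : ℝ, 0 ≤ X ∧ EntriesBounded T L X ∧ Fintype.card ι * X < c ^ L := by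
  obtain ⟨C, hC0, hC⟩ := h.exists_nonneg hr
  obtain ⟨L, hL, hL0⟩ := ((eventually_mul_pow_lt hr hrc (Fintype.card ι * C)).and
    (Filter.eventually_gt_atTop 0)).exists
  exact ⟨L, hL0, C * r ^ L, by positivity, fun w hw i j => hw ▸ hC w i j, by rwa [← mul_assoc]⟩

/-- Completeness of the lower test. If it failed for all `L`, every rate at which the products are
bounded could be lowered by a fixed factor `q < 1`, eventually below `c'`. -/
theorem exists_lt_of_not_productsBounded [Finite κ] {T : κ → Matrix ι ι ℝ} {c c' : ℝ}
    (h : ¬ ProductsBounded T c') (hc : 0 < c) (hcc : c < c') :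
    ∃ L > 0, ∃ X : ℝ, 0 ≤ X ∧ EntriesBounded T L X ∧ ∃ w : List κ, w.length = Fintype.card ι * L ∧
      ∃ i j, bochiConst (Fintype.card ι) * c ^ L * X ^ (Fintype.card ι - 1) <
        |(w.map T).prod i j| := by
  set N := Fintype.card ι with hN
  have hc' : 0 < c' := hc.trans hcc
  have hN0 : 0 < N := by
    rw [hN, Fintype.card_pos_iff]
    by_contra hne
    rw [not_nonempty_iff] at hne
    exact h ⟨0, fun w i => isEmptyElim i⟩
  by_contra! hcon
  obtain ⟨q, hq, hq0, hq1⟩ : ∃ q : ℝ, c / c' < q ^ N ∧ 0 < q ∧ q < 1 := by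
    have h1 : Filter.Tendsto (fun q : ℝ => q ^ N) (nhdsWithin 1 (Set.Iio 1)) (nhds 1) :=
      ((continuous_pow N).tendsto' 1 1 (one_pow N)).mono_left nhdsWithin_le_nhds
    have h2 := h1.eventually_const_lt ((div_lt_one hc').2 hcc)
    have h3 : ∀ᶠ q : ℝ in nhdsWithin 1 (Set.Iio 1), 0 < q :=
      nhdsWithin_le_nhds (lt_mem_nhds one_pos)
    obtain ⟨q, hq⟩ := (h2.and (h3.and self_mem_nhdsWithin)).exists
    exact ⟨q, hq.1, hq.2.1, hq.2.2⟩
  have hstep : ∀ r, 0 < r → ProductsBounded T r → ProductsBounded T (q * r) := by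
    intro r hr hbd
    have hcr : c' ≤ r := by
      by_contra hlt
      exact h (hbd.mono hr.le (not_le.1 hlt).le)
    obtain ⟨C, hC0, hC⟩ := hbd.exists_nonneg hr.le
    -- Without a violation, the products of length `N * L` are at most a constant times `(c * r ^ (N
    -- - 1)) ^ L`. As `r ≥ c'` and `q ^ N > c / c'`, this is eventually below `(q * r) ^ (N * L)`,
    -- even after multiplication by `N`.
    have hlt : c * r ^ (N - 1) < (q * r) ^ N := by
      have h1 : c < q ^ N * r := by
        rw [div_lt_iff₀ hc'] at hq
        exact hq.trans_le (by gcongr)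
      have h2 : r ^ N = r * r ^ (N - 1) := by rw [← pow_succ']; congr 1; omega
      rw [mul_pow, h2, ← mul_assoc]
      exact mul_lt_mul_of_pos_right h1 (by positivity)
    obtain ⟨L, hL, hL0⟩ := ((eventually_mul_pow_lt (by positivity) hlt
      (N * (bochiConst N * C ^ (N - 1)))).and (Filter.eventually_gt_atTop 0)).exists
    have hE : EntriesBounded T (N * L) (bochiConst N * c ^ L * (C * r ^ L) ^ (N - 1)) :=
      fun w hw i j => hcon L hL0 (C * r ^ L) (by positivity) (fun w hw i j => hw ▸ hC w i j) w hw i j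
    refine hE.productsBounded (Nat.mul_pos hN0 hL0) (by positivity) ?_
    rw [pow_mul, ← hN]
    refine (le_of_eq ?_).trans hL.le
    rw [mul_pow C, mul_pow c, ← pow_mul, ← pow_mul, mul_comm L]
    ring
  obtain ⟨b, hb, hbw⟩ := exists_abs_list_prod_le T
  have hall : ∀ k : ℕ, ProductsBounded T (q ^ k * b) := by
    intro k
    induction k with
    | zero => exact ⟨1, fun w i j => by simpa using hbw w i j⟩
    | succ k ih =>
      rw [pow_succ', mul_assoc]
      exact hstep _ (by positivity) ih
  obtain ⟨k, hk⟩ := ((tendsto_pow_atTop_nhds_zero_of_lt_one hq0.le hq1).mul_const b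
    |>.eventually_lt_const (show 0 * b < c' by rwa [zero_mul])).exists
  exact h ((hall k).mono (by positivity) hk.le)

theorem ProductsBounded.exists_norm_le {T : κ → Matrix ι ι ℝ} {c : ℝ} (h : ProductsBounded T c) :
    ∃ C : ℝ, ∀ (w : List κ) (u : ι → ℝ), ‖(w.map T).prod.mulVec u‖ ≤ C * ‖u‖ * c ^ w.length := by
  obtain ⟨C, hC⟩ := h
  exact ⟨Fintype.card ι * C, fun w u =>
    (norm_mulVec_le (hC w) u).trans (le_of_eq (by ring))⟩

/-- Suffixes are initial stretches of time. If every unit vector and word of length `L` had a suffix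
growing by less than `c ^ length`, such stretches could be removed repeatedly until fewer than `L`
letters remain, and the products would be bounded at rate `c`. -/
theorem exists_word_of_not_productsBounded [Finite κ] {T : κ → Matrix ι ι ℝ} {c : ℝ} (hc : 0 < c)
    (h : ¬ ProductsBounded T c) (L : ℕ) :
    ∃ w : List κ, w.length = L ∧ ∃ u : ι → ℝ, ‖u‖ = 1 ∧
      ∀ w', w' <:+ w → c ^ w'.length ≤ ‖(w'.map T).prod.mulVec u‖ := by
  by_contra! hneg
  obtain ⟨b, hb, hbw⟩ := exists_abs_list_prod_le T
  set C := Fintype.card ι * max 1 (b / c) ^ L with hC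
  have hC0 : 0 ≤ C := by positivity
  have key : ∀ (w : List κ) (u : ι → ℝ), ‖(w.map T).prod.mulVec u‖ ≤ C * c ^ w.length * ‖u‖ := by
    intro w
    induction hn : w.length using Nat.strong_induction_on generalizing w with
    | _ l ih =>
      intro u
      by_cases hlL : l < L
      · have h1 : b ^ w.length ≤ max 1 (b / c) ^ L * c ^ l := by
          rw [hn]; exact pow_le_max_pow_mul hb hc hlL.le
        refine (norm_mulVec_le (fun i j => (hbw w i j).trans h1) u).trans (le_of_eq ?_)
        rw [hC]; ring
      · by_cases hu : u = 0
        · subst hu; simp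
        have hu0 : 0 < ‖u‖ := norm_pos_iff.2 hu
        obtain ⟨w', hw', hlt⟩ := hneg (w.drop (l - L)) (by rw [List.length_drop]; omega)
          (‖u‖⁻¹ • u) (by rw [norm_smul, norm_inv, norm_norm, inv_mul_cancel₀ hu0.ne'])
        rw [Matrix.mulVec_smul, norm_smul, norm_inv, norm_norm, inv_mul_lt_iff₀ hu0] at hlt
        obtain ⟨w2, hw2⟩ := hw'.trans (List.drop_suffix _ _)
        -- The empty suffix gives growth exactly `1 = c ^ 0`, so a bad suffix makes the word
        -- strictly shorter.
        have hne : w' ≠ [] := by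
          rintro rfl
          simp at hlt
        have hlen : w2.length + w'.length = l := by rw [← hn, ← hw2, List.length_append]
        have hpos : 0 < w'.length := List.length_pos_iff.2 hne
        have h1 := ih w2.length (by omega) w2 rfl ((w'.map T).prod.mulVec u)
        rw [← hw2, List.map_append, List.prod_append, ← Matrix.mulVec_mulVec]
        refine h1.trans ?_
        calc C * c ^ w2.length * ‖(w'.map T).prod.mulVec u‖
            ≤ C * c ^ w2.length * (‖u‖ * c ^ w'.length) := by gcongr
          _ = C * c ^ l * ‖u‖ := by rw [← hlen, pow_add]; ring
  refine h ⟨C, fun w i j => ?_⟩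
  have h1 := (norm_le_pi_norm _ i).trans (key w (Pi.single j 1))
  rw [Matrix.mulVec_single_one, Pi.norm_single, norm_one, mul_one] at h1
  exact h1

end Products

/-! ### Infinite switching signals from finite words -/

namespace SwitchedDelaySystem

theorem exists_hist_eq {κ : Type*} [Nonempty κ] (w : List κ) : ∃ σ : ℕ → κ, hist σ w.length = w := by
  have hcongr : ∀ (t : ℕ) (σ σ' : ℕ → κ), (∀ s < t, σ s = σ' s) → hist σ t = hist σ' t := by
    intro t
    induction t with
    | zero => intros; rfl
    | succ t ih =>
      intro σ σ' h
      rw [hist, hist, h t (Nat.lt_succ_self t), ih σ σ' fun s hs => h s (by omega)]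
  induction w with
  | nil => exact ⟨fun _ => Classical.arbitrary κ, rfl⟩
  | cons d w ih =>
    obtain ⟨σ, hσ⟩ := ih
    refine ⟨Function.update σ w.length d, ?_⟩
    rw [List.length_cons, hist, Function.update_self, hcongr _ _ σ, hσ]
    intro s hs
    exact Function.update_of_ne hs.ne _ _

theorem hist_suffix {κ : Type*} (σ : ℕ → κ) {s t : ℕ} (hst : s ≤ t) : hist σ s <:+ hist σ t := by
  induction t, hst using Nat.le_induction with
  | base => exact List.suffix_rfl
  | succ t _ ih => exact ih.trans (List.suffix_cons _ _)

/-- Compactness of the unit sphere times `ℕ → κ`, with `κ` finite and discrete: the pairs satisfying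
the lower bound up to time `L` form a decreasing sequence of nonempty closed sets. -/
theorem exists_signal_of_not_productsBounded {ι κ : Type*} [Fintype ι] [DecidableEq ι] [Finite κ]
    [Nonempty κ] {T : κ → Matrix ι ι ℝ} {c : ℝ} (hc : 0 < c) (h : ¬ ProductsBounded T c) :
    ∃ (σ : ℕ → κ) (u : ι → ℝ), ‖u‖ = 1 ∧
      ∀ t, c ^ t ≤ ‖((hist σ t).map T).prod.mulVec u‖ := by
  let _ : TopologicalSpace κ := ⊥
  have _ : DiscreteTopology κ := ⟨rfl⟩
  let V : ℕ → Set ((ι → ℝ) × (ℕ → κ)) := fun L =>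
    {p | ‖p.1‖ = 1 ∧ ∀ t ≤ L, c ^ t ≤ ‖((hist p.2 t).map T).prod.mulVec p.1‖}
  have hcont : ∀ t, Continuous fun p : (ι → ℝ) × (ℕ → κ) =>
      ((hist p.2 t).map T).prod.mulVec p.1 := by
    intro t
    refine Continuous.matrix_mulVec ?_ continuous_fst
    induction t with
    | zero => exact continuous_const
    | succ t ih =>
      refine Continuous.matrix_mul (A := fun p : (ι → ℝ) × (ℕ → κ) => T (p.2 t)) ?_ ih
      exact (continuous_of_discreteTopology (f := T)).comp
        ((continuous_apply t).comp continuous_snd)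
  have hclosed : ∀ L, IsClosed (V L) := by
    intro L
    have hV : V L = {p | ‖p.1‖ = 1} ∩ ⋂ t, ⋂ (_ : t ≤ L),
        {p | c ^ t ≤ ‖((hist p.2 t).map T).prod.mulVec p.1‖} := by
      ext p; simp [V]
    rw [hV]
    exact (isClosed_eq continuous_fst.norm continuous_const).inter <| isClosed_iInter fun t => isClosed_iInter fun _ =>
      isClosed_le continuous_const (hcont t).norm
  have hne : ∀ L, (V L).Nonempty := by
    intro L
    obtain ⟨w, hw, u, hu, hwu⟩ := exists_word_of_not_productsBounded hc h L
    obtain ⟨σ, hσ⟩ := exists_hist_eq w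
    refine ⟨(u, σ), hu, fun t ht => ?_⟩
    have := hwu (hist σ t) (by rw [← hσ]; exact hist_suffix σ (by omega))
    rwa [length_hist] at this
  have hcompact : IsCompact (V 0) := by
    refine ((isCompact_sphere (0 : ι → ℝ) 1).prod isCompact_univ).of_isClosed_subset (hclosed 0) ?_
    rintro p ⟨hp, -⟩
    exact ⟨by simpa using hp, trivial⟩
  obtain ⟨p, hp⟩ := IsCompact.nonempty_iInter_of_sequence_nonempty_isCompact_isClosed V
    (fun L p hp => ⟨hp.1, fun t ht => hp.2 t (by omega)⟩) hne hcompact hclosed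
  rw [Set.mem_iInter] at hp
  exact ⟨p.2, p.1, (hp 0).1, fun t => (hp t).2 t le_rfl⟩

/-! ### Growth of the trajectories -/

variable {n m : ℕ} {D : Finset ℕ}

theorem growthAtMost_of_productsBounded {S : SwitchedDelaySystem n m D ℝ} {c : ℝ}
    (h : ProductsBounded S.trans c) : S.GrowthAtMost c := by
  obtain ⟨C, hC⟩ := h.exists_norm_le
  refine ⟨C, fun τ t => ?_⟩
  have := hC (hist (fun t : ℕ => τ.σ t) t) (extState τ.σ τ.x τ.v 0)
  rwa [← run_eq_mulVec, ← τ.extState_eq, length_hist] at this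

theorem growthAtLeast_of_not_productsBounded {S : SwitchedDelaySystem n m D ℝ} (hD : D.Nonempty)
    {c : ℝ} (hc : 0 < c) (h : ¬ ProductsBounded S.trans c) : S.GrowthAtLeast c := by
  have : Nonempty D := hD.to_subtype
  obtain ⟨σ, u, -, hσ⟩ := exists_signal_of_not_productsBounded hc h
  obtain ⟨τ, hτ⟩ := exists_trajectory S hD σ u
  refine ⟨1, one_pos, τ, fun t => ?_⟩
  rw [one_mul, Trajectory.size, hτ, run_eq_mulVec]
  exact hσ t

/-- As `0 ^ 0 = 1`, rate zero still requires a nonzero initial state. A coordinate `i` provides one.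
-/
theorem growthAtLeast_zero (S : SwitchedDelaySystem n m D ℝ) (hD : D.Nonempty)
    (i : Fin n ⊕ Fin (D.sup id) × Fin m) : S.GrowthAtLeast 0 := by
  obtain ⟨d, hd⟩ := hD
  obtain ⟨τ, hτ⟩ := exists_trajectory S ⟨d, hd⟩ (fun _ => ⟨d, hd⟩) (Pi.single i 1)
  refine ⟨1, one_pos, τ, fun t => ?_⟩
  rcases t with _ | t
  · simp [Trajectory.size, hτ, hist, Pi.norm_single]
  · simp [Trajectory.size]

theorem ofReal_rpow_one_div_le {a c : ℝ} {t : ℕ} (ht : 0 < t) (hc : 0 ≤ c) (h : a ≤ c ^ t) :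
    ENNReal.ofReal a ^ (1 / (t : ℝ)) ≤ ENNReal.ofReal c := by
  rw [one_div, ENNReal.rpow_inv_le_iff (by exact_mod_cast ht), ENNReal.rpow_natCast,
    ← ENNReal.ofReal_pow hc]
  exact ENNReal.ofReal_le_ofReal h

theorem le_ofReal_rpow_one_div {a c : ℝ} {t : ℕ} (ht : 0 < t) (hc : 0 ≤ c) (h : c ^ t ≤ a) :
    ENNReal.ofReal c ≤ ENNReal.ofReal a ^ (1 / (t : ℝ)) := by
  rw [one_div, ENNReal.le_rpow_inv_iff (by exact_mod_cast ht), ENNReal.rpow_natCast,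
    ← ENNReal.ofReal_pow hc]
  exact ENNReal.ofReal_le_ofReal h

theorem growthRate_le_of_growthAtMost {S : SwitchedDelaySystem n m D ℝ} {c c' : ℝ} (hc : 0 ≤ c)
    (hcc : c < c') (h : S.GrowthAtMost c) : S.growthRate ≤ ENNReal.ofReal c' := by
  obtain ⟨C, hC⟩ := h
  refine iSup_le fun τ => Filter.limsup_le_of_le (by isBoundedDefault) ?_
  filter_upwards [eventually_mul_pow_lt hc hcc (C * τ.size 0), Filter.eventually_gt_atTop 0]
    with t ht ht0
  exact ofReal_rpow_one_div_le ht0 (hc.trans hcc.le) ((hC τ t).trans ht.le)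

theorem le_growthRate_of_growthAtLeast {S : SwitchedDelaySystem n m D ℝ} {c c' : ℝ} (hc : 0 ≤ c)
    (hcc : c < c') (h : S.GrowthAtLeast c') : ENNReal.ofReal c ≤ S.growthRate := by
  obtain ⟨C, hC0, τ, hC⟩ := h
  refine le_trans ?_ (le_iSup _ τ)
  refine Filter.le_limsup_of_frequently_le (Filter.Eventually.frequently ?_) (by isBoundedDefault)
  filter_upwards [eventually_mul_pow_lt hc hcc C⁻¹, Filter.eventually_gt_atTop 0] with t ht ht0
  refine le_ofReal_rpow_one_div ht0 hc (le_trans ?_ (hC t))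
  rw [inv_mul_lt_iff₀ hC0] at ht
  exact ht.le

end SwitchedDelaySystem

/-! ### Integer arithmetic on lists -/

section ListArithmetic

/-- The dot product of the list `a` with (an initial segment of) the list `b`. -/
def listDot (a b : List ℤ) : ℤ :=
  ((List.range a.length).map fun i => a.getD i 0 * b.getD i 0).sum

theorem map_range_eq_ofFn {α : Type*} (n : ℕ) (f : ℕ → α) :
    (List.range n).map f = List.ofFn fun i : Fin n => f i :=
  List.ext_getElem (by simp) (by simp)

theorem getD_ofFn {α : Type*} {n : ℕ} (f : Fin n → α) (k : ℕ) (d : α) :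
    (List.ofFn f).getD k d = if h : k < n then f ⟨k, h⟩ else d := by
  rw [List.getD_eq_getElem?_getD, List.getElem?_ofFn]
  split_ifs <;> rfl

theorem listDot_eq_sum_zipWith (a b : List ℤ) (h : a.length = b.length) :
    listDot a b = (List.zipWith (· * ·) a b).sum := by
  rw [listDot]
  congr 1
  refine List.ext_getElem (by simp [h]) fun i h1 h2 => ?_
  simp only [List.length_map, List.length_range] at h1
  simp [h1, h ▸ h1]

theorem sum_zipWith_ofFn {n : ℕ} (f g : Fin n → ℤ) :
    (List.zipWith (· * ·) (List.ofFn f) (List.ofFn g)).sum = ∑ i, f i * g i := by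
  rw [← List.sum_ofFn]
  congr 1
  exact List.ext_getElem (by simp) (by simp)

theorem sum_zipWith_flatten_ofFn {k n : ℕ} (f g : Fin k → Fin n → ℤ) :
    (List.zipWith (· * ·) (List.ofFn fun s => List.ofFn (f s)).flatten
      (List.ofFn fun s => List.ofFn (g s)).flatten).sum = ∑ s, ∑ j, f s j * g s j := by
  induction k with
  | zero => simp
  | succ k ih =>
    rw [List.ofFn_succ, List.ofFn_succ, List.flatten_cons, List.flatten_cons,
      List.zipWith_append (by simp), List.sum_append, sum_zipWith_ofFn, ih, Fin.sum_univ_succ]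

theorem length_flatten_ofFn {α : Type*} {k n : ℕ} (f : Fin k → Fin n → α) :
    (List.ofFn fun s => List.ofFn (f s)).flatten.length = k * n := by
  simp [List.length_flatten, List.map_ofFn, Function.comp_def]

theorem listDot_ofFn {n : ℕ} (f g : Fin n → ℤ) :
    listDot (List.ofFn f) (List.ofFn g) = ∑ i, f i * g i := by
  rw [listDot_eq_sum_zipWith _ _ (by simp), sum_zipWith_ofFn]

end ListArithmetic

/-! ### Extended states and transitions as lists of integers -/

/-- An extended state, as the list of the coordinates of `x` and the list of `u_1, u_2, …`. -/
abbrev ListState : Type := List ℤ × List (List ℤ)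

/-- All coordinates of an extended state, in the order of the columns of the feedback matrices. -/
def ListState.coords (u : ListState) : List ℤ := u.1 ++ u.2.flatten

/-- The control signal computed from the rows of the feedback matrix. -/
def listFeedback (K : List (List ℤ)) (u : ListState) : List ℤ :=
  K.map fun row => listDot row u.coords

/-- The input of the plant, up to scaling. -/
def listInput (m : ℕ) (s : ℤ) (d : ℕ) (v : List ℤ) (u : ListState) : List ℤ :=
  (List.range m).map fun j => s * (u.2.getD 0 []).getD j 0 + if d = 0 then v.getD j 0 else 0

/-- The next state of the plant, up to scaling. -/
def listPlant (n : ℕ) (A B : List (List ℤ)) (s : ℤ) (x w : List ℤ) : List ℤ :=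
  (List.range n).map fun i => s * listDot (A.getD i []) x + listDot (B.getD i []) w

/-- The next list of pending inputs, up to scaling. -/
def listPending (m : ℕ) (s : ℤ) (d : ℕ) (v : List ℤ) (u : ListState) : List (List ℤ) :=
  (List.range u.2.length).map fun k => (List.range m).map fun j =>
    s * s * (u.2.getD (k + 1) []).getD j 0 + if d = k + 1 then s * v.getD j 0 else 0

/-- The closed-loop transition on lists. -/
def listStep (c : SystemCode) (s : ℤ) (dK : ℕ × List (List ℤ)) (u : ListState) : ListState :=
  (listPlant c.1 c.2.2.1 c.2.2.2.1 s u.1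
      (listInput c.2.1 s dK.1 (listFeedback dK.2 u) u),
    listPending c.2.1 s dK.1 (listFeedback dK.2 u) u)

/-- The maximal delay. -/
def listMaxDelay (c : SystemCode) : ℕ := (c.2.2.2.2.map Prod.fst).foldr max 0

/-- The basis vectors of the space of extended states. -/
def listBasis (c : SystemCode) : List ListState :=
  ((List.range c.1).map fun i => ((List.range c.1).map fun a => if a = i then 1 else 0,
    (List.range (listMaxDelay c)).map fun _ => (List.range c.2.1).map fun _ => 0)) ++
  (List.range (listMaxDelay c)).flatMap fun k => (List.range c.2.1).map fun j =>
    ((List.range c.1).map fun _ => 0,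
      (List.range (listMaxDelay c)).map fun k' => (List.range c.2.1).map fun j' =>
        if k' = k then (if j' = j then 1 else 0) else 0)

/-- The images of all basis vectors under all products of `L` transitions. -/
def listOrbit (c : SystemCode) (s : ℤ) (L : ℕ) : List ListState :=
  Nat.rec (listBasis c)
    (fun _ o => o.flatMap fun u => c.2.2.2.2.map fun dK => listStep c s dK u) L

/-- The maximum of the absolute values of all coordinates. -/
def listMaxAbs (o : List ListState) : ℕ :=
  (o.flatMap ListState.coords).foldr (fun x a => max x.natAbs a) 0

/-- The sum of the absolute values of all coordinates. -/
def listSumAbs (o : List ListState) : ℕ :=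
  (o.map fun u => (u.coords.map Int.natAbs).sum).sum

/-- Apply a function to all entries of the matrices of a system. -/
def mapCode (f : ℤ → ℤ) (c : SystemCode) : SystemCode :=
  (c.1, c.2.1, c.2.2.1.map (List.map f), c.2.2.2.1.map (List.map f),
    c.2.2.2.2.map fun dK => (dK.1, dK.2.map (List.map f)))

theorem listMaxAbs_le_iff (o : List ListState) {x : ℝ} (hx : 0 ≤ x) :
    (listMaxAbs o : ℝ) ≤ x ↔ ∀ u ∈ o, ∀ z ∈ u.coords, |(z : ℝ)| ≤ x := by
  have h : ∀ l : List ℤ, ((l.foldr (fun x a => max x.natAbs a) 0 : ℕ) : ℝ) ≤ x ↔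
      ∀ z ∈ l, |(z : ℝ)| ≤ x := by
    intro l
    induction l with
    | nil => simpa using hx
    | cons z l ih =>
      rw [List.foldr_cons, Nat.cast_max, max_le_iff, ih, List.forall_mem_cons, Nat.cast_natAbs,
        Int.cast_abs]
  rw [listMaxAbs, h]
  simp only [List.mem_flatMap]
  exact ⟨fun h u hu z hz => h z ⟨u, hu, hz⟩, fun h z ⟨u, hu, hz⟩ => h u hu z hz⟩

/-! ### Agreement of the list computations with the transition maps -/

namespace SwitchedDelaySystem

variable {n m : ℕ} {D : Finset ℕ}

/-- The list form of an extended state. -/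
def listState (u : Fin n ⊕ Fin (D.sup id) × Fin m → ℤ) : ListState :=
  (List.ofFn fun i => u (Sum.inl i), List.ofFn fun s => List.ofFn fun j => u (Sum.inr (s, j)))

/-- The rows of a feedback matrix. -/
def codeK (q : SwitchedDelaySystem n m D ℤ) (d : D) : List (List ℤ) :=
  List.ofFn fun i => (listState (q.K d i)).coords

/-- The delays in increasing order. -/
noncomputable def delays (D : Finset ℕ) : List D :=
  (D.sort (· ≤ ·)).attach.map fun d => ⟨d.1, (Finset.mem_sort _).1 d.2⟩

theorem mem_delays (d : D) : d ∈ delays D := by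
  rw [delays, List.mem_map]
  exact ⟨⟨d.1, (Finset.mem_sort _).2 d.2⟩, List.mem_attach _ _, rfl⟩

theorem code_eq (q : SwitchedDelaySystem n m D ℤ) :
    q.code = (n, m, List.ofFn fun i => List.ofFn fun j => q.A i j,
      List.ofFn fun i => List.ofFn fun j => q.B i j,
      (delays D).map fun d : D => ((d : ℕ), q.codeK d)) := by
  rw [code, delays, List.map_map]; rfl

theorem mapCode_code (f : ℤ → ℤ) (q : SwitchedDelaySystem n m D ℤ) :
    mapCode f q.code = (q.map f).code := by
  simp only [mapCode, code_eq, List.map_ofFn, List.map_map, codeK, listState, ListState.coords,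
    Function.comp_def, List.map_append, List.map_flatten, map, Matrix.map_apply]

theorem listMaxDelay_code (q : SwitchedDelaySystem n m D ℤ) :
    listMaxDelay q.code = D.sup id := by
  have h : ∀ l : List ℕ, ∀ b, l.foldr max 0 ≤ b ↔ ∀ a ∈ l, a ≤ b := by
    intro l b
    induction l with
    | nil => simp
    | cons a l ih => simp [ih]
  refine eq_of_forall_ge_iff fun b => ?_
  rw [listMaxDelay, code_eq, h, Finset.sup_le_iff, List.map_map, List.forall_mem_map]
  exact ⟨fun h d hd => h ⟨d, hd⟩ (mem_delays _), fun h d _ => h d.1 d.2⟩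

theorem mem_coords_listState (u : Fin n ⊕ Fin (D.sup id) × Fin m → ℤ) (z : ℤ) :
    z ∈ (listState u).coords ↔ ∃ i, u i = z := by
  simp only [ListState.coords, listState, List.mem_append, List.mem_ofFn, List.mem_flatten,
    Sum.exists, Prod.exists]
  constructor
  · rintro (h | ⟨l, ⟨s, rfl⟩, h⟩)
    · exact Or.inl h
    · rw [List.mem_ofFn] at h
      obtain ⟨j, hj⟩ := h
      exact Or.inr ⟨s, j, hj⟩
  · rintro (h | ⟨s, j, h⟩)
    · exact Or.inl h
    · exact Or.inr ⟨_, ⟨s, rfl⟩, List.mem_ofFn.2 ⟨j, h⟩⟩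

theorem sum_natAbs_coords_listState (u : Fin n ⊕ Fin (D.sup id) × Fin m → ℤ) :
    ((listState u).coords.map Int.natAbs).sum = ∑ i, (u i).natAbs := by
  simp only [ListState.coords, listState, List.map_append, List.map_ofFn, List.map_flatten,
    List.sum_append, List.sum_ofFn, List.sum_flatten, Fintype.sum_sum_type, Fintype.sum_prod_type,
    Function.comp_def]

theorem listDot_coords (u v : Fin n ⊕ Fin (D.sup id) × Fin m → ℤ) :
    listDot (listState u).coords (listState v).coords = ∑ i, u i * v i := by
  rw [listDot_eq_sum_zipWith]
  · simp only [ListState.coords, listState]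
    rw [List.zipWith_append (by simp), List.sum_append, sum_zipWith_ofFn,
      sum_zipWith_flatten_ofFn, Fintype.sum_sum_type, Fintype.sum_prod_type]
  · simp only [ListState.coords, listState, List.length_append, length_flatten_ofFn,
      List.length_ofFn]

theorem listFeedback_codeK (q : SwitchedDelaySystem n m D ℤ) (d : D) (u) :
    listFeedback (q.codeK d) (listState u) = List.ofFn fun j => (q.K d).mulVec u j := by
  simp only [listFeedback, codeK, List.map_ofFn, Function.comp_def, listDot_coords]
  rfl

theorem getD_getD_listState (u : Fin n ⊕ Fin (D.sup id) × Fin m → ℤ) (k : ℕ) (j : Fin m) :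
    ((listState u).2.getD k []).getD j 0 = pend u k j := by
  rw [listState, getD_ofFn, pend]
  split_ifs with h
  · rw [getD_ofFn, dif_pos j.2]
  · rfl

theorem listStep_code (q : SwitchedDelaySystem n m D ℤ) (s : ℤ) (d : D) (u) :
    listStep q.code s ((d : ℕ), q.codeK d) (listState u) = listState (q.step s d u) := by
  have hv : ∀ j : Fin m, (List.ofFn fun j => (q.K d).mulVec u j).getD (j : ℕ) 0 =
      (q.K d).mulVec u j := fun j => by rw [getD_ofFn, dif_pos j.2]
  have hlen : (listState u).2.length = D.sup id := by simp [listState]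
  refine Prod.ext ?_ ?_
  · simp only [listStep, listPlant, code_eq, listFeedback_codeK, listInput, map_range_eq_ofFn,
      getD_getD_listState, getD_ofFn, Fin.is_lt, dite_true, Fin.eta]
    simp only [listState, listDot_ofFn, step, Sum.elim_inl]
    rfl
  · simp only [listStep, listPending, code_eq, listFeedback_codeK, map_range_eq_ofFn, hv,
      getD_getD_listState, hlen]
    rfl

/-- All coordinates. -/
def coordList (n m : ℕ) (D : Finset ℕ) : List (Fin n ⊕ Fin (D.sup id) × Fin m) :=
  (List.ofFn Sum.inl) ++ (List.ofFn fun s => List.ofFn fun j => Sum.inr (s, j)).flatten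

/-- All pairs of a word of length `L` and a coordinate. -/
noncomputable def words (n m : ℕ) (D : Finset ℕ) :
    ℕ → List (List D × (Fin n ⊕ Fin (D.sup id) × Fin m))
  | 0 => (coordList n m D).map fun i => ([], i)
  | L + 1 => (words n m D L).flatMap fun p => (delays D).map fun d => (d :: p.1, p.2)

theorem mem_words (L : ℕ) (p : List D × (Fin n ⊕ Fin (D.sup id) × Fin m)) :
    p ∈ words n m D L ↔ p.1.length = L := by
  induction L generalizing p with
  | zero =>
    have h : ∀ i, i ∈ coordList n m D := by
      rintro (i | ⟨s, j⟩)
      · simp [coordList]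
      · simp only [coordList, List.mem_append, List.mem_flatten]
        exact Or.inr ⟨_, List.mem_ofFn.2 ⟨s, rfl⟩, List.mem_ofFn.2 ⟨j, rfl⟩⟩
    rcases p with ⟨w, i⟩
    simp [words, h, eq_comm]
  | succ L ih =>
    rcases p with ⟨_ | ⟨d, w⟩, i⟩
    · simp [words]
    · simp only [words, List.mem_flatMap, List.mem_map, Prod.mk.injEq, List.cons.injEq,
        List.length_cons, Nat.add_right_cancel_iff]
      constructor
      · rintro ⟨p, hp, d', -, ⟨-, rfl⟩, -⟩
        exact (ih _).1 hp
      · intro h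
        exact ⟨(w, i), (ih _).2 h, d, mem_delays d, ⟨rfl, rfl⟩, rfl⟩

theorem listBasis_code (q : SwitchedDelaySystem n m D ℤ) :
    listBasis q.code = (coordList n m D).map fun i => listState (Pi.single i 1) := by
  rw [listBasis, listMaxDelay_code, code_eq, coordList, List.map_append, List.map_flatten,
    List.map_ofFn, List.map_ofFn, List.flatMap_def]
  simp only [map_range_eq_ofFn, List.map_ofFn, Function.comp_def, listState, Pi.single_apply,
    Sum.inl.injEq, Sum.inr.injEq, Prod.mk.injEq, reduceCtorEq, if_false, Fin.ext_iff, ite_and]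

/-- The list program computes all columns of all products of length `L`; `words` repeats its order
of enumeration. -/
theorem listOrbit_code (q : SwitchedDelaySystem n m D ℤ) (s : ℤ) (L : ℕ) :
    listOrbit q.code s L =
      (words n m D L).map fun p => listState (q.run s p.1 (Pi.single p.2 1)) := by
  induction L with
  | zero =>
    change listBasis q.code = _
    rw [listBasis_code, words, List.map_map]; rfl
  | succ L ih =>
    change ((listOrbit q.code s L).flatMap fun u =>
      q.code.2.2.2.2.map fun dK => listStep q.code s dK u) = _
    have hK : q.code.2.2.2.2 = (delays D).map fun d : D => ((d : ℕ), q.codeK d) := by rw [code_eq]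
    rw [ih, hK, words, List.map_flatMap, List.flatMap_map]
    simp only [List.map_map, Function.comp_def, listStep_code, run_cons]

end SwitchedDelaySystem

/-! ### Error bounds -/

/-- Quadruples `(x, x', y, z)` such that `y` majorizes `x'` and `z - y` majorizes `x - x'`. -/
def majorantSubsemiring : Subsemiring (ℝ × ℝ × ℝ × ℝ) where
  carrier := {p | |p.2.1| ≤ p.2.2.1 ∧ |p.1 - p.2.1| ≤ p.2.2.2 - p.2.2.1}
  zero_mem' := by simp
  one_mem' := by simp
  add_mem' := by
    rintro ⟨x, x', y, z⟩ ⟨a, a', b, c⟩ ⟨h1, h2⟩ ⟨h3, h4⟩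
    refine ⟨(abs_add_le _ _).trans (add_le_add h1 h3), ?_⟩
    have : x + a - (x' + a') = (x - x') + (a - a') := by ring
    simp only [Prod.mk_add_mk, this]
    exact (abs_add_le _ _).trans (by dsimp only at h2 h4; linarith)
  mul_mem' := by
    rintro ⟨x, x', y, z⟩ ⟨a, a', b, c⟩ ⟨h1, h2⟩ ⟨h3, h4⟩
    dsimp only at h1 h2 h3 h4
    refine ⟨?_, ?_⟩
    · simp only [Prod.mk_mul_mk, abs_mul]
      exact mul_le_mul h1 h3 (abs_nonneg _) ((abs_nonneg _).trans h1)
    · have h5 : |a| ≤ c := by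
        have := abs_add_le (a - a') a'
        rw [sub_add_cancel] at this
        linarith
      -- The two terms are at most `(z - y) * c` and `y * (c - b)`, which add up to `z * c - y * b`.
      have : x * a - x' * a' = (x - x') * a + x' * (a - a') := by ring
      simp only [Prod.mk_mul_mk, this]
      refine (abs_add_le _ _).trans ?_
      rw [abs_mul, abs_mul]
      have h6 : |x - x'| * |a| ≤ (z - y) * c :=
        mul_le_mul h2 h5 (abs_nonneg _) ((abs_nonneg _).trans h2)
      have h7 : |x'| * |a - a'| ≤ y * (c - b) :=
        mul_le_mul h1 h4 (abs_nonneg _) ((abs_nonneg _).trans h1)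
      linarith

/-- Pairs of a sequence and its limit. -/
def limitSubsemiring : Subsemiring ((ℕ → ℝ) × ℝ) where
  carrier := {p | Filter.Tendsto p.1 Filter.atTop (nhds p.2)}
  zero_mem' := tendsto_const_nhds
  one_mem' := tendsto_const_nhds
  add_mem' h h' := Filter.Tendsto.add h h'
  mul_mem' h h' := Filter.Tendsto.mul h h'

namespace SwitchedDelaySystem

variable {n m : ℕ} {D : Finset ℕ}

theorem map_single_one {ι R R' : Type} [DecidableEq ι] [CommRing R] [CommRing R'] (φ : R →+* R')
    (j : ι) : (fun i => φ ((Pi.single j 1 : ι → R) i)) = Pi.single j 1 := by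
  ext i
  simp only [Pi.single_apply, apply_ite φ, map_one, map_zero]

theorem map_run_single {R R' : Type} [CommRing R] [CommRing R'] (φ : R →+* R')
    (S : SwitchedDelaySystem n m D R) (s : R) (w : List D) (j i) :
    φ (S.run s w (Pi.single j 1) i) = (S.map φ).run (φ s) w (Pi.single j 1) i := by
  rw [map_run, map_single_one]

theorem single_one_mem {ι R : Type} [DecidableEq ι] [CommRing R] (T : Subsemiring R) (j i : ι) :
    (Pi.single j 1 : ι → R) i ∈ T := by
  rw [Pi.single_apply]
  split_ifs
  exacts [T.one_mem, T.zero_mem]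

theorem run_majorant {S S' Y Z : SwitchedDelaySystem n m D ℝ}
    (hA : ∀ i j, |S'.A i j| ≤ Y.A i j ∧ |S.A i j - S'.A i j| ≤ Z.A i j - Y.A i j)
    (hB : ∀ i j, |S'.B i j| ≤ Y.B i j ∧ |S.B i j - S'.B i j| ≤ Z.B i j - Y.B i j)
    (hK : ∀ d i j, |S'.K d i j| ≤ Y.K d i j ∧ |S.K d i j - S'.K d i j| ≤ Z.K d i j - Y.K d i j)
    (w : List D) (j i) :
    |S'.run 1 w (Pi.single j 1) i| ≤ Y.run 1 w (Pi.single j 1) i ∧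
      |S.run 1 w (Pi.single j 1) i - S'.run 1 w (Pi.single j 1) i| ≤
        Z.run 1 w (Pi.single j 1) i - Y.run 1 w (Pi.single j 1) i := by
  let Q : SwitchedDelaySystem n m D (ℝ × ℝ × ℝ × ℝ) :=
    { A := fun i j => (S.A i j, S'.A i j, Y.A i j, Z.A i j)
      B := fun i j => (S.B i j, S'.B i j, Y.B i j, Z.B i j)
      K := fun d i j => (S.K d i j, S'.K d i j, Y.K d i j, Z.K d i j) }
  have hQ : Q.EntriesMem majorantSubsemiring := ⟨hA, hB, hK⟩
  have h := run_mem hQ (one_mem _) w (single_one_mem majorantSubsemiring j) i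
  have h1 := map_run_single (RingHom.fst ℝ (ℝ × ℝ × ℝ)) Q 1 w j i
  have h2 := map_run_single ((RingHom.fst ℝ (ℝ × ℝ)).comp (RingHom.snd ℝ (ℝ × ℝ × ℝ))) Q 1 w j i
  have h3 := map_run_single (((RingHom.fst ℝ ℝ).comp (RingHom.snd ℝ (ℝ × ℝ))).comp
    (RingHom.snd ℝ (ℝ × ℝ × ℝ))) Q 1 w j i
  have h4 := map_run_single (((RingHom.snd ℝ ℝ).comp (RingHom.snd ℝ (ℝ × ℝ))).comp
    (RingHom.snd ℝ (ℝ × ℝ × ℝ))) Q 1 w j i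
  rw [map_one] at h1 h2 h3 h4
  change _ = S.run 1 w _ i at h1
  change _ = S'.run 1 w _ i at h2
  change _ = Y.run 1 w _ i at h3
  change _ = Z.run 1 w _ i at h4
  rw [← h1, ← h2, ← h3, ← h4]
  exact h

theorem tendsto_run {S : ℕ → SwitchedDelaySystem n m D ℝ} {S' : SwitchedDelaySystem n m D ℝ}
    (hA : ∀ i j, Filter.Tendsto (fun k => (S k).A i j) Filter.atTop (nhds (S'.A i j)))
    (hB : ∀ i j, Filter.Tendsto (fun k => (S k).B i j) Filter.atTop (nhds (S'.B i j)))
    (hK : ∀ d i j, Filter.Tendsto (fun k => (S k).K d i j) Filter.atTop (nhds (S'.K d i j)))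
    (w : List D) (j i) :
    Filter.Tendsto (fun k => (S k).run 1 w (Pi.single j 1) i) Filter.atTop
      (nhds (S'.run 1 w (Pi.single j 1) i)) := by
  let Q : SwitchedDelaySystem n m D ((ℕ → ℝ) × ℝ) :=
    { A := fun i j => (fun k => (S k).A i j, S'.A i j)
      B := fun i j => (fun k => (S k).B i j, S'.B i j)
      K := fun d i j => (fun k => (S k).K d i j, S'.K d i j) }
  have hQ : Q.EntriesMem limitSubsemiring := ⟨hA, hB, hK⟩
  have h := run_mem hQ (one_mem _) w (single_one_mem limitSubsemiring j) i
  have h1 := map_run_single (RingHom.snd (ℕ → ℝ) ℝ) Q 1 w j i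
  have h2 : ∀ k, (Q.run 1 w (Pi.single j 1) i).1 k = (S k).run 1 w (Pi.single j 1) i := by
    intro k
    have := map_run_single ((Pi.evalRingHom (fun _ : ℕ => ℝ) k).comp (RingHom.fst (ℕ → ℝ) ℝ))
      Q 1 w j i
    rw [map_one] at this
    exact this
  rw [map_one] at h1
  change _ = S'.run 1 w _ i at h1
  rw [← h1, ← funext h2]
  exact h

/-- The system whose entries have the given numerators and the denominator `2 ^ k`. -/
noncomputable def dyadic (q : SwitchedDelaySystem n m D ℤ) (k : ℕ) :
    SwitchedDelaySystem n m D ℝ :=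
  q.map fun z : ℤ => (z : ℝ) / 2 ^ k

theorem intCast_run (q : SwitchedDelaySystem n m D ℤ) (k : ℕ) (w : List D) (j i) :
    ((q.run (2 ^ k) w (Pi.single j 1) i : ℤ) : ℝ) =
      (2 ^ k * 2 ^ k) ^ w.length * (q.dyadic k).run 1 w (Pi.single j 1) i := by
  have h := map_run_single (Int.castRingHom ℝ) q (2 ^ k) w j i
  have hq : q.map (Int.castRingHom ℝ) = (q.dyadic k).map ((2 : ℝ) ^ k * ·) := by
    have hz : ∀ z : ℤ, (Int.castRingHom ℝ) z = (2 : ℝ) ^ k * ((z : ℝ) / 2 ^ k) := fun z =>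
      (mul_div_cancel₀ _ (by positivity)).symm
    simp only [dyadic, map, Matrix.map, hz, Matrix.of_apply]
  rw [hq, map_pow, map_ofNat, run_map_mul] at h
  exact h

end SwitchedDelaySystem

/-! ### Computable bounds for the entries and the errors -/

/-- The largest entry of the approximate products of length `L`, up to scaling. -/
def approxMax (c : SystemCode) (k L : ℕ) : ℕ := listMaxAbs (listOrbit c (2 ^ k) L)

/-- A bound for the errors of the approximate products of length `L`, up to scaling. -/
def approxError (c : SystemCode) (k L : ℕ) : ℕ :=
  listSumAbs (listOrbit (mapCode (fun z : ℤ => (z.natAbs : ℤ) + 1) c) (2 ^ k) L) -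
    listSumAbs (listOrbit (mapCode (fun z : ℤ => (z.natAbs : ℤ)) c) (2 ^ k) L)

namespace SwitchedDelaySystem

variable {n m : ℕ} {D : Finset ℕ}

theorem listSumAbs_listOrbit_code (q : SwitchedDelaySystem n m D ℤ) (s : ℤ) (L : ℕ) :
    listSumAbs (listOrbit q.code s L) =
      ((words n m D L).map fun p =>
        ∑ i, (q.run s p.1 (Pi.single p.2 1) i).natAbs).sum := by
  simp only [listSumAbs, listOrbit_code, List.map_map, Function.comp_def,
    sum_natAbs_coords_listState]

variable {S : SwitchedDelaySystem n m D ℝ} {q : ℕ → SwitchedDelaySystem n m D ℤ}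

/-- The error bound of a single approximate product. -/
noncomputable def entryError (q : SwitchedDelaySystem n m D ℤ) (k : ℕ) (w : List D)
    (j i : Fin n ⊕ Fin (D.sup id) × Fin m) : ℝ :=
  ((q.map fun z : ℤ => (z.natAbs : ℤ) + 1).dyadic k).run 1 w (Pi.single j 1) i -
    ((q.map fun z : ℤ => (z.natAbs : ℤ)).dyadic k).run 1 w (Pi.single j 1) i

theorem isDyadicName_majorant {a : ℝ} {p : ℕ → ℤ} (h : IsDyadicName a p) (k : ℕ) :
    |(p k : ℝ) / 2 ^ k| ≤ (((p k).natAbs : ℤ) : ℝ) / 2 ^ k ∧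
      |a - (p k : ℝ) / 2 ^ k| ≤
        (((p k).natAbs + 1 : ℤ) : ℝ) / 2 ^ k - (((p k).natAbs : ℤ) : ℝ) / 2 ^ k := by
  have h1 : (((p k).natAbs : ℤ) : ℝ) = |(p k : ℝ)| := by
    rw [Int.natCast_natAbs, Int.cast_abs]
  constructor
  · rw [h1, abs_div, abs_of_pos (a := (2 : ℝ) ^ k) (by positivity)]
  · refine (h k).trans (le_of_eq ?_)
    rw [← sub_div]
    push_cast
    ring

theorem isDyadicName_tendsto {a : ℝ} {p : ℕ → ℤ} (h : IsDyadicName a p) :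
    Filter.Tendsto (fun k => (p k : ℝ) / 2 ^ k) Filter.atTop (nhds a) := by
  rw [tendsto_iff_dist_tendsto_zero]
  refine squeeze_zero (fun _ => dist_nonneg) (fun k => ?_)
    (tendsto_pow_atTop_nhds_zero_of_lt_one (r := (1 / 2 : ℝ)) (by norm_num) (by norm_num))
  rw [dist_comm, Real.dist_eq, one_div_pow]
  exact h k

theorem isDyadicName_tendsto_abs {a : ℝ} {p : ℕ → ℤ} (h : IsDyadicName a p) :
    Filter.Tendsto (fun k => (((p k).natAbs : ℤ) : ℝ) / 2 ^ k) Filter.atTop (nhds |a|) := by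
  refine (isDyadicName_tendsto h).abs.congr fun k => ?_
  rw [abs_div, abs_of_pos (a := (2 : ℝ) ^ k) (by positivity), Int.natCast_natAbs, Int.cast_abs]

theorem isDyadicName_tendsto_abs_add_one {a : ℝ} {p : ℕ → ℤ} (h : IsDyadicName a p) :
    Filter.Tendsto (fun k => (((p k).natAbs + 1 : ℤ) : ℝ) / 2 ^ k) Filter.atTop (nhds |a|) := by
  have h1 := (isDyadicName_tendsto_abs h).add
    (tendsto_pow_atTop_nhds_zero_of_lt_one (r := (1 / 2 : ℝ)) (by norm_num) (by norm_num))
  rw [add_zero] at h1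
  refine h1.congr fun k => ?_
  rw [one_div_pow]
  push_cast
  ring

/-- The majorants have entries `|q| / 2 ^ k` and `(|q| + 1) / 2 ^ k`; their difference `1 / 2 ^ k`
is exactly the precision of a name. -/
theorem IsName.abs_run_sub_le (h : S.IsName q) (k : ℕ) (w : List D) (j i) :
    |S.run 1 w (Pi.single j 1) i - ((q k).dyadic k).run 1 w (Pi.single j 1) i| ≤
      entryError (q k) k w j i ∧
    0 ≤ (((q k).map fun z : ℤ => (z.natAbs : ℤ)).dyadic k).run 1 w (Pi.single j 1) i := by
  have := run_majorant (S := S) (S' := (q k).dyadic k)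
    (Y := ((q k).map fun z : ℤ => (z.natAbs : ℤ)).dyadic k)
    (Z := ((q k).map fun z : ℤ => (z.natAbs : ℤ) + 1).dyadic k)
    (fun i j => by
      simpa only [dyadic, map_A_apply] using isDyadicName_majorant (h.1 i j) k) (fun i j => by
      simpa only [dyadic, map_B_apply] using isDyadicName_majorant (h.2.1 i j) k)
    (fun d i j => by
      simpa only [dyadic, map_K_apply] using isDyadicName_majorant (h.2.2 d i j) k) w j i
  exact ⟨this.2, (abs_nonneg _).trans this.1⟩

/-- Both majorizing systems converge to the system of absolute values, so their runs along a fixed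
word have the same limit. -/
theorem IsName.tendsto_entryError (h : S.IsName q) (w : List D) (j i) :
    Filter.Tendsto (fun k => entryError (q k) k w j i) Filter.atTop (nhds 0) := by
  have h1 := tendsto_run (S := fun k => ((q k).map fun z : ℤ => (z.natAbs : ℤ) + 1).dyadic k)
    (S' := S.map fun x => |x|) (fun i j => by
      simpa only [dyadic, map_A_apply] using isDyadicName_tendsto_abs_add_one (h.1 i j))
    (fun i j => by
      simpa only [dyadic, map_B_apply] using isDyadicName_tendsto_abs_add_one (h.2.1 i j))
    (fun d i j => by
      simpa only [dyadic, map_K_apply] using isDyadicName_tendsto_abs_add_one (h.2.2 d i j)) w j i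
  have h2 := tendsto_run (S := fun k => ((q k).map fun z : ℤ => (z.natAbs : ℤ)).dyadic k)
    (S' := S.map fun x => |x|) (fun i j => by
      simpa only [dyadic, map_A_apply] using isDyadicName_tendsto_abs (h.1 i j))
    (fun i j => by
      simpa only [dyadic, map_B_apply] using isDyadicName_tendsto_abs (h.2.1 i j))
    (fun d i j => by
      simpa only [dyadic, map_K_apply] using isDyadicName_tendsto_abs (h.2.2 d i j)) w j i
  have h3 := h1.sub h2
  rwa [sub_self] at h3

/-- All majorant runs are nonnegative, so the absolute values can be dropped, and the first sum
dominates the second, so the subtraction of natural numbers in `approxError` is not truncated. -/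
theorem IsName.approxError_eq (h : S.IsName q) (k L : ℕ) :
    (approxError (q k).code k L : ℝ) = (2 ^ k * 2 ^ k) ^ L *
      ((words n m D L).map fun p => ∑ i, entryError (q k) k p.1 p.2 i).sum := by
  have hcast : ∀ q' : SwitchedDelaySystem n m D ℤ,
      (∀ w j i, 0 ≤ (q'.dyadic k).run 1 w (Pi.single j 1) i) →
      (listSumAbs (listOrbit q'.code (2 ^ k) L) : ℝ) = (2 ^ k * 2 ^ k) ^ L *
        ((words n m D L).map fun p => ∑ i, (q'.dyadic k).run 1 p.1 (Pi.single p.2 1) i).sum := by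
    intro q' hq'
    rw [listSumAbs_listOrbit_code, Nat.cast_list_sum, List.map_map, ← List.sum_map_mul_left]
    congr 1
    refine List.map_congr_left fun p hp => ?_
    rw [Function.comp_apply, Nat.cast_sum, Finset.mul_sum]
    refine Finset.sum_congr rfl fun i _ => ?_
    rw [Nat.cast_natAbs, Int.cast_abs, intCast_run, (mem_words L p).1 hp, abs_of_nonneg]
    exact mul_nonneg (by positivity) (hq' _ _ _)
  have h1 := hcast _ fun w j i => (h.abs_run_sub_le k w j i).2
  have h2 := hcast ((q k).map fun z : ℤ => (z.natAbs : ℤ) + 1) fun w j i => by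
    have := h.abs_run_sub_le k w j i
    have h3 := (abs_nonneg _).trans this.1
    rw [entryError] at h3
    linarith [this.2]
  have hle : listSumAbs (listOrbit ((q k).map fun z : ℤ => (z.natAbs : ℤ)).code (2 ^ k) L) ≤
      listSumAbs (listOrbit ((q k).map fun z : ℤ => (z.natAbs : ℤ) + 1).code (2 ^ k) L) := by
    rw [← Nat.cast_le (α := ℝ), h1, h2]
    refine mul_le_mul_of_nonneg_left (List.sum_le_sum fun p _ => Finset.sum_le_sum fun i _ => ?_)
      (by positivity)
    have := (abs_nonneg _).trans (h.abs_run_sub_le k p.1 p.2 i).1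
    rw [entryError] at this
    linarith
  rw [approxError, mapCode_code, mapCode_code, Nat.cast_sub hle, h1, h2, ← mul_sub]
  congr 1
  simp only [entryError, Finset.sum_sub_distrib]
  induction words n m D L with
  | nil => simp
  | cons p l ih => simp only [List.map_cons, List.sum_cons]; rw [← ih]; ring

theorem IsName.entryError_le (h : S.IsName q) (k : ℕ) (w : List D) (j i) :
    (2 ^ k * 2 ^ k) ^ w.length * entryError (q k) k w j i ≤
      approxError (q k).code k w.length := by
  have hnn : ∀ w j i, 0 ≤ entryError (q k) k w j i := fun w j i =>
    (abs_nonneg _).trans (h.abs_run_sub_le k w j i).1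
  rw [h.approxError_eq]
  refine mul_le_mul_of_nonneg_left ?_ (by positivity)
  refine (Finset.single_le_sum (f := fun i => entryError (q k) k w j i) (fun i _ => hnn w j i)
    (Finset.mem_univ i)).trans ?_
  refine List.single_le_sum ?_ _ (List.mem_map.2 ⟨(w, j), (mem_words _ _).2 rfl, rfl⟩)
  intro x hx
  obtain ⟨p, -, rfl⟩ := List.mem_map.1 hx
  exact Finset.sum_nonneg fun i _ => hnn _ _ i

theorem IsName.tendsto_approxError (h : S.IsName q) (L : ℕ) :
    Filter.Tendsto (fun k => (approxError (q k).code k L : ℝ) / (2 ^ k * 2 ^ k) ^ L) Filter.atTop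
      (nhds 0) := by
  have h1 : ∀ l : List (List D × (Fin n ⊕ Fin (D.sup id) × Fin m)), Filter.Tendsto
      (fun k => (l.map fun p => ∑ i, entryError (q k) k p.1 p.2 i).sum) Filter.atTop
      (nhds 0) := by
    intro l
    induction l with
    | nil => simp
    | cons p l ih =>
      simp only [List.map_cons, List.sum_cons]
      have := (tendsto_finsetSum Finset.univ
        fun i _ => h.tendsto_entryError p.1 p.2 i).add ih
      simpa using this
  refine (h1 (words n m D L)).congr fun k => ?_
  rw [h.approxError_eq, mul_div_cancel_left₀ _ (by positivity)]

theorem approxMax_le_iff (q : SwitchedDelaySystem n m D ℤ) (k L : ℕ) {x : ℝ} (hx : 0 ≤ x) :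
    (approxMax q.code k L : ℝ) ≤ (2 ^ k * 2 ^ k) ^ L * x ↔
      ∀ w : List D, w.length = L → ∀ j i, |(q.dyadic k).run 1 w (Pi.single j 1) i| ≤ x := by
  rw [approxMax, listMaxAbs_le_iff _ (by positivity), listOrbit_code, List.forall_mem_map]
  have key : ∀ (w : List D) j i, w.length = L →
      (|((q.run (2 ^ k) w (Pi.single j 1) i : ℤ) : ℝ)| ≤ (2 ^ k * 2 ^ k) ^ L * x ↔
        |(q.dyadic k).run 1 w (Pi.single j 1) i| ≤ x) := by
    intro w j i hw
    rw [intCast_run, hw, abs_mul, abs_of_nonneg (a := ((2 : ℝ) ^ k * 2 ^ k) ^ L) (by positivity)]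
    exact mul_le_mul_iff_right₀ (by positivity)
  constructor
  · intro h w hw j i
    exact (key w j i hw).1 (h (w, j) ((mem_words _ _).2 hw) _
      ((mem_coords_listState _ _).2 ⟨i, rfl⟩))
  · intro h p hp z hz
    obtain ⟨i, rfl⟩ := (mem_coords_listState _ _).1 hz
    have hw := (mem_words _ _).1 hp
    exact (key p.1 p.2 i hw).2 (h p.1 hw p.2 i)

/-- An upper bound for the entries of the products of length `L`. -/
theorem IsName.entriesBounded (h : S.IsName q) (k L : ℕ) :
    EntriesBounded S.trans L
      (((approxMax (q k).code k L + approxError (q k).code k L : ℕ) : ℝ) /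
        (2 ^ k * 2 ^ k) ^ L) := by
  intro w hw i j
  have hE : (0 : ℝ) < (2 ^ k * 2 ^ k) ^ L := by positivity
  have h1 := (approxMax_le_iff (q k) k L
    (x := (approxMax (q k).code k L : ℝ) / (2 ^ k * 2 ^ k) ^ L) (by positivity)).1
    (by rw [mul_div_cancel₀ _ hE.ne']) w hw j i
  have h2 := h.entryError_le k w j i
  rw [hw] at h2
  have h3 := (h.abs_run_sub_le k w j i).1
  rw [← le_div_iff₀' hE] at h2
  rw [← run_single, Nat.cast_add, add_div]
  have h4 := abs_add_le (S.run 1 w (Pi.single j 1) i - ((q k).dyadic k).run 1 w (Pi.single j 1) i)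
    (((q k).dyadic k).run 1 w (Pi.single j 1) i)
  rw [sub_add_cancel] at h4
  linarith

/-- A lower bound for the entries of the products of length `L`. -/
theorem IsName.approxMax_div_le (h : S.IsName q) (k : ℕ) {L : ℕ} {x : ℝ} (hx : 0 ≤ x)
    (hS : EntriesBounded S.trans L x) :
    (approxMax (q k).code k L : ℝ) / (2 ^ k * 2 ^ k) ^ L ≤
      x + approxError (q k).code k L / (2 ^ k * 2 ^ k) ^ L := by
  have hE : (0 : ℝ) < (2 ^ k * 2 ^ k) ^ L := by positivity
  rw [div_le_iff₀' hE, approxMax_le_iff _ _ _ (by positivity)]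
  intro w hw j i
  have h2 := h.entryError_le k w j i
  rw [hw, ← le_div_iff₀' hE] at h2
  have h3 := (h.abs_run_sub_le k w j i).1
  have h4 := hS w hw i j
  rw [← run_single] at h4
  rw [abs_sub_comm] at h3
  have h5 := abs_add_le (((q k).dyadic k).run 1 w (Pi.single j 1) i -
    S.run 1 w (Pi.single j 1) i) (S.run 1 w (Pi.single j 1) i)
  rw [sub_add_cancel] at h5
  linarith

end SwitchedDelaySystem

/-! ### Primitive recursion on integers and lists -/

namespace Primrec

variable {α β σ : Type*} [Primcodable α] [Primcodable β] [Primcodable σ]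

theorem nat_pow {f g : α → ℕ} (hf : Primrec f) (hg : Primrec g) :
    Primrec fun a => f a ^ g a :=
  (Primrec₂.unpaired'.1 Nat.Primrec.pow).comp hf hg

theorem encode_int_natCast (n : ℕ) : Encodable.encode (n : ℤ) = 2 * n := rfl

theorem encode_int_negSucc (n : ℕ) : Encodable.encode (Int.negSucc n) = 2 * n + 1 := rfl

theorem int_toNat : Primrec Int.toNat := by
  have h : Primrec fun z : ℤ =>
      if Encodable.encode z % 2 = 0 then Encodable.encode z / 2 else 0 :=
    Primrec.ite (Primrec.eq.comp (nat_mod.comp Primrec.encode (const 2)) (const 0))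
      (nat_div.comp Primrec.encode (const 2)) (const 0)
  refine h.of_eq fun z => ?_
  rcases z with n | n
  · rw [Int.ofNat_eq_natCast, encode_int_natCast, if_pos (by omega), Int.toNat_natCast]; omega
  · rw [encode_int_negSucc, if_neg (by omega)]; rfl

theorem int_toNat_neg : Primrec fun z : ℤ => (-z).toNat := by
  have h : Primrec fun z : ℤ =>
      if Encodable.encode z % 2 = 0 then 0 else Encodable.encode z / 2 + 1 :=
    Primrec.ite (Primrec.eq.comp (nat_mod.comp Primrec.encode (const 2)) (const 0))
      (const 0) (succ.comp (nat_div.comp Primrec.encode (const 2)))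
  refine h.of_eq fun z => ?_
  rcases z with n | n
  · rw [Int.ofNat_eq_natCast, encode_int_natCast, if_pos (by omega)]; omega
  · rw [encode_int_negSucc, if_neg (by omega)]; omega

/-- Integers are encoded by even numbers (nonnegative) and odd numbers (negative). Sums and products
of integers reduce to such differences by splitting each integer into positive and negative part. -/
theorem int_sub_nat {f g : α → ℕ} (hf : Primrec f) (hg : Primrec g) :
    Primrec fun a => (f a : ℤ) - g a := by
  rw [← Primrec.encode_iff]
  have h : Primrec fun a => if g a ≤ f a then 2 * (f a - g a) else 2 * (g a - f a - 1) + 1 :=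
    Primrec.ite (nat_le.comp hg hf) (nat_mul.comp (const 2) (nat_sub.comp hf hg))
      (succ.comp (nat_mul.comp (const 2) (nat_sub.comp (nat_sub.comp hg hf) (const 1))))
  refine h.of_eq fun a => ?_
  split_ifs with hle
  · rw [← Int.ofNat_sub hle, encode_int_natCast]
  · have : (f a : ℤ) - g a = Int.negSucc (g a - f a - 1) := by omega
    rw [this, encode_int_negSucc]

theorem int_natCast {f : α → ℕ} (hf : Primrec f) : Primrec fun a => (f a : ℤ) :=
  (int_sub_nat hf (const 0)).of_eq fun a => by simp

theorem int_natAbs : Primrec Int.natAbs :=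
  (nat_add.comp int_toNat int_toNat_neg).of_eq fun z => by omega

theorem int_add {f g : α → ℤ} (hf : Primrec f) (hg : Primrec g) :
    Primrec fun a => f a + g a :=
  (int_sub_nat (nat_add.comp (int_toNat.comp hf) (int_toNat.comp hg))
    (nat_add.comp (int_toNat_neg.comp hf) (int_toNat_neg.comp hg))).of_eq fun a => by
      push_cast; omega

theorem int_mul {f g : α → ℤ} (hf : Primrec f) (hg : Primrec g) :
    Primrec fun a => f a * g a :=
  (int_sub_nat
    (nat_add.comp (nat_mul.comp (int_toNat.comp hf) (int_toNat.comp hg))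
      (nat_mul.comp (int_toNat_neg.comp hf) (int_toNat_neg.comp hg)))
    (nat_add.comp (nat_mul.comp (int_toNat.comp hf) (int_toNat_neg.comp hg))
      (nat_mul.comp (int_toNat_neg.comp hf) (int_toNat.comp hg)))).of_eq fun a => by
      have h1 : f a = (f a).toNat - (-f a).toNat := by omega
      have h2 : g a = (g a).toNat - (-g a).toNat := by omega
      conv_rhs => rw [h1, h2]
      push_cast
      ring

theorem int_list_sum : Primrec (List.sum : List ℤ → ℤ) :=
  (list_foldr Primrec.id (const 0)
    (int_add (fst.comp snd) (snd.comp snd)).to₂).of_eq fun _ => List.sum_eq_foldr.symm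

theorem nat_list_sum : Primrec (List.sum : List ℕ → ℕ) :=
  (list_foldr Primrec.id (const 0)
    (nat_add.comp (fst.comp snd) (snd.comp snd)).to₂).of_eq fun _ => List.sum_eq_foldr.symm

theorem map_range {f : α → ℕ} {g : α → ℕ → σ} (hf : Primrec f)
    (hg : Primrec fun p : α × ℕ => g p.1 p.2) : Primrec fun a => (List.range (f a)).map (g a) :=
  list_map (list_range.comp hf) hg

theorem getD {f : α → List σ} {g : α → ℕ} (d : σ) (hf : Primrec f) (hg : Primrec g) :
    Primrec fun a => (f a).getD (g a) d :=
  (list_getD d).comp hf hg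

end Primrec

/-! ### Primitive recursiveness of the list computations -/

section ListPrimrec

open Primrec

variable {α : Type*} [Primcodable α]

theorem primrec_listDot {f g : α → List ℤ} (hf : Primrec f) (hg : Primrec g) :
    Primrec fun a => listDot (f a) (g a) :=
  int_list_sum.comp <| map_range (list_length.comp hf) <|
    int_mul (getD 0 (hf.comp fst) snd) (getD 0 (hg.comp fst) snd)

theorem primrec_coords : Primrec ListState.coords :=
  list_append.comp fst (list_flatten.comp snd)

theorem primrec_listFeedback {K : α → List (List ℤ)} {u : α → ListState} (hK : Primrec K)
    (hu : Primrec u) : Primrec fun a => listFeedback (K a) (u a) :=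
  list_map hK (primrec_listDot snd (primrec_coords.comp (hu.comp fst)))

theorem primrec_pending {u : α → ListState} {k j : α → ℕ} (hu : Primrec u) (hk : Primrec k)
    (hj : Primrec j) : Primrec fun a => ((u a).2.getD (k a) []).getD (j a) 0 :=
  getD 0 (getD [] (snd.comp hu) hk) hj

theorem primrec_listInput {m d : α → ℕ} {s : α → ℤ} {v : α → List ℤ} {u : α → ListState}
    (hm : Primrec m) (hs : Primrec s) (hd : Primrec d) (hv : Primrec v) (hu : Primrec u) :
    Primrec fun a => listInput (m a) (s a) (d a) (v a) (u a) :=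
  map_range hm <| int_add
    (int_mul (hs.comp fst) (primrec_pending (hu.comp fst) (const 0) snd))
    (Primrec.ite (Primrec.eq.comp (hd.comp fst) (const 0)) (getD 0 (hv.comp fst) snd) (const 0))

theorem primrec_listPlant {n : α → ℕ} {A B : α → List (List ℤ)} {s : α → ℤ} {x w : α → List ℤ}
    (hn : Primrec n) (hA : Primrec A) (hB : Primrec B) (hs : Primrec s) (hx : Primrec x)
    (hw : Primrec w) : Primrec fun a => listPlant (n a) (A a) (B a) (s a) (x a) (w a) :=
  map_range hn <| int_add
    (int_mul (hs.comp fst) (primrec_listDot (getD [] (hA.comp fst) snd) (hx.comp fst)))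
    (primrec_listDot (getD [] (hB.comp fst) snd) (hw.comp fst))

theorem primrec_listPending {m d : α → ℕ} {s : α → ℤ} {v : α → List ℤ} {u : α → ListState}
    (hm : Primrec m) (hs : Primrec s) (hd : Primrec d) (hv : Primrec v) (hu : Primrec u) :
    Primrec fun a => listPending (m a) (s a) (d a) (v a) (u a) :=
  map_range (list_length.comp (snd.comp hu)) <| map_range (hm.comp fst) <| int_add
    (int_mul (int_mul (hs.comp (fst.comp fst)) (hs.comp (fst.comp fst)))
      (primrec_pending (hu.comp (fst.comp fst)) (succ.comp (snd.comp fst)) snd))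
    (Primrec.ite (Primrec.eq.comp (hd.comp (fst.comp fst)) (succ.comp (snd.comp fst)))
      (int_mul (hs.comp (fst.comp fst)) (getD 0 (hv.comp (fst.comp fst)) snd)) (const 0))

theorem primrec_listStep {c : α → SystemCode} {s : α → ℤ} {dK : α → ℕ × List (List ℤ)}
    {u : α → ListState} (hc : Primrec c) (hs : Primrec s) (hdK : Primrec dK) (hu : Primrec u) :
    Primrec fun a => listStep (c a) (s a) (dK a) (u a) := by
  have hv := primrec_listFeedback (snd.comp hdK) hu
  have hm := fst.comp (snd.comp hc)
  exact pair
    (primrec_listPlant (fst.comp hc) (fst.comp (snd.comp (snd.comp hc)))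
      (fst.comp (snd.comp (snd.comp (snd.comp hc)))) hs (fst.comp hu)
      (primrec_listInput hm hs (fst.comp hdK) hv hu))
    (primrec_listPending hm hs (fst.comp hdK) hv hu)

theorem primrec_delayRows {c : α → SystemCode} (hc : Primrec c) :
    Primrec fun a => (c a).2.2.2.2 :=
  snd.comp (snd.comp (snd.comp (snd.comp hc)))

theorem primrec_listMaxDelay {c : α → SystemCode} (hc : Primrec c) :
    Primrec fun a => listMaxDelay (c a) :=
  list_foldr (list_map (primrec_delayRows hc) (fst.comp snd).to₂) (const 0)
    (nat_max.comp (fst.comp snd) (snd.comp snd)).to₂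

theorem primrec_listBasis {c : α → SystemCode} (hc : Primrec c) :
    Primrec fun a => listBasis (c a) := by
  have hn := fst.comp hc
  have hm := fst.comp (snd.comp hc)
  have hd := primrec_listMaxDelay hc
  refine list_append.comp (map_range hn (pair (map_range (hn.comp fst) ?_)
    (map_range (hd.comp fst) (map_range (hm.comp (fst.comp fst)) (const 0))))) ?_
  · exact Primrec.ite (Primrec.eq.comp snd (snd.comp fst)) (const 1) (const 0)
  · have h0 : Primrec fun p : (((α × ℕ) × ℕ) × ℕ) × ℕ =>
        if p.1.2 = p.1.1.1.2 then (if p.2 = p.1.1.2 then (1 : ℤ) else 0) else 0 :=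
      Primrec.ite (Primrec.eq.comp (snd.comp fst) (snd.comp (fst.comp (fst.comp fst))))
        (Primrec.ite (Primrec.eq.comp snd (snd.comp (fst.comp fst))) (const 1) (const 0)) (const 0)
    have h1 : Primrec fun p : (α × ℕ) × ℕ => (List.range (listMaxDelay (c p.1.1))).map fun k' =>
        (List.range (c p.1.1).2.1).map fun j' =>
          if k' = p.1.2 then (if j' = p.2 then (1 : ℤ) else 0) else 0 :=
      map_range (hd.comp (fst.comp fst))
        (map_range (hm.comp (fst.comp (fst.comp fst))) h0)
    have h2 : Primrec fun p : (α × ℕ) × ℕ => (List.range (c p.1.1).1).map fun _ => (0 : ℤ) :=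
      map_range (hn.comp (fst.comp fst)) (const 0)
    have h3 := h2.pair h1
    have h4 : Primrec fun p : α × ℕ => (List.range (c p.1).2.1).map fun j =>
        ((List.range (c p.1).1).map fun _ => (0 : ℤ),
          (List.range (listMaxDelay (c p.1))).map fun k' => (List.range (c p.1).2.1).map fun j' =>
            if k' = p.2 then (if j' = j then (1 : ℤ) else 0) else 0) :=
      map_range (hm.comp fst) h3
    exact list_flatMap (list_range.comp hd) h4.to₂

theorem primrec_listOrbit {c : α → SystemCode} {s : α → ℤ} {L : α → ℕ} (hc : Primrec c)
    (hs : Primrec s) (hL : Primrec L) : Primrec fun a => listOrbit (c a) (s a) (L a) :=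
  nat_rec' hL (primrec_listBasis hc) <| Primrec.to₂ <|
    list_flatMap (snd.comp snd) <| Primrec.to₂ <|
      list_map (primrec_delayRows (hc.comp (fst.comp fst))) <| Primrec.to₂ <|
        primrec_listStep (hc.comp (fst.comp (fst.comp fst))) (hs.comp (fst.comp (fst.comp fst)))
          snd (snd.comp fst)

theorem primrec_listMaxAbs : Primrec listMaxAbs :=
  list_foldr (list_flatMap Primrec.id (primrec_coords.comp snd).to₂) (const 0)
    (nat_max.comp (int_natAbs.comp (fst.comp snd)) (snd.comp snd)).to₂

theorem primrec_listSumAbs : Primrec listSumAbs :=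
  nat_list_sum.comp <| list_map Primrec.id <| Primrec.to₂ <|
    nat_list_sum.comp <| list_map (primrec_coords.comp snd) (int_natAbs.comp snd).to₂

theorem primrec_map_map {f : ℤ → ℤ} (hf : Primrec f) {l : α → List (List ℤ)} (hl : Primrec l) :
    Primrec fun a => (l a).map (List.map f) :=
  list_map hl (list_map snd (hf.comp snd).to₂).to₂

theorem primrec_mapCode {f : ℤ → ℤ} (hf : Primrec f) {c : α → SystemCode} (hc : Primrec c) :
    Primrec fun a => mapCode f (c a) :=
  pair (fst.comp hc) <| pair (fst.comp (snd.comp hc)) <|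
    pair (primrec_map_map hf (fst.comp (snd.comp (snd.comp hc)))) <|
      pair (primrec_map_map hf (fst.comp (snd.comp (snd.comp (snd.comp hc))))) <|
        list_map (primrec_delayRows hc)
          (pair (fst.comp snd) (primrec_map_map hf (snd.comp snd))).to₂

theorem primrec_int_two_pow {k : α → ℕ} (hk : Primrec k) : Primrec fun a => (2 : ℤ) ^ k a :=
  (int_natCast (nat_pow (const 2) hk)).of_eq fun a => by push_cast; rfl

theorem primrec_approxMax {c : α → SystemCode} {k L : α → ℕ} (hc : Primrec c) (hk : Primrec k)
    (hL : Primrec L) : Primrec fun a => approxMax (c a) (k a) (L a) :=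
  primrec_listMaxAbs.comp (primrec_listOrbit hc (primrec_int_two_pow hk) hL)

theorem primrec_approxError {c : α → SystemCode} {k L : α → ℕ} (hc : Primrec c) (hk : Primrec k)
    (hL : Primrec L) : Primrec fun a => approxError (c a) (k a) (L a) := by
  have hnat : Primrec fun z : ℤ => (z.natAbs : ℤ) := int_natCast int_natAbs
  exact nat_sub.comp
    (primrec_listSumAbs.comp (primrec_listOrbit
      (primrec_mapCode (int_add hnat (const 1)) hc) (primrec_int_two_pow hk) hL))
    (primrec_listSumAbs.comp (primrec_listOrbit
      (primrec_mapCode hnat hc) (primrec_int_two_pow hk) hL))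

end ListPrimrec

/-! ### The certificates -/

/-- The dimension of the space of extended states. -/
def codeDim (c : SystemCode) : ℕ := c.1 + listMaxDelay c * c.2.1

/-- The square of the common denominator of the data, to the power `L`. -/
def scaleFactor (k L : ℕ) : ℕ := (2 ^ k * 2 ^ k) ^ L

/-- The approximations of the products of length `L` show that the products grow at most like
`(a / b) ^ length`. -/
def UpperCertificate (c : SystemCode) (k L a b : ℕ) : Prop :=
  0 < L ∧ codeDim c * (approxMax c k L + approxError c k L) * b ^ L ≤ a ^ L * scaleFactor k L

/-- The approximations of the products of the lengths `L` and `codeDim c * L` show that the products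
do not grow at most like `(a / b) ^ length`. -/
def LowerCertificate (c : SystemCode) (k L a b : ℕ) : Prop :=
  bochiConst (codeDim c) * a ^ L * (approxMax c k L + approxError c k L) ^ (codeDim c - 1) *
      scaleFactor k (codeDim c * L) +
    approxError c k (codeDim c * L) * (b ^ L * scaleFactor k L ^ (codeDim c - 1)) <
  approxMax c k (codeDim c * L) * (b ^ L * scaleFactor k L ^ (codeDim c - 1))

instance (c : SystemCode) (k L a b : ℕ) : Decidable (UpperCertificate c k L a b) :=
  inferInstanceAs (Decidable (_ ∧ _))

instance (c : SystemCode) (k L a b : ℕ) : Decidable (LowerCertificate c k L a b) :=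
  inferInstanceAs (Decidable (_ < _))

section CertificatePrimrec

open Primrec

variable {α : Type*} [Primcodable α] {c : α → SystemCode} {k L a b : α → ℕ}

theorem primrec_codeDim (hc : Primrec c) : Primrec fun x => codeDim (c x) :=
  nat_add.comp (fst.comp hc) (nat_mul.comp (primrec_listMaxDelay hc) (fst.comp (snd.comp hc)))

theorem primrec_scaleFactor (hk : Primrec k) (hL : Primrec L) :
    Primrec fun x => scaleFactor (k x) (L x) :=
  nat_pow (nat_mul.comp (nat_pow (const 2) hk) (nat_pow (const 2) hk)) hL

theorem primrec_bochiConst (hk : Primrec k) : Primrec fun x => bochiConst (k x) :=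
  nat_mul.comp (nat_pow hk (const 5))
    (nat_pow (nat_pow hk (const 3)) (nat_sub.comp hk (const 1)))

theorem primrecPred_upperCertificate (hc : Primrec c) (hk : Primrec k) (hL : Primrec L)
    (ha : Primrec a) (hb : Primrec b) :
    PrimrecPred fun x => UpperCertificate (c x) (k x) (L x) (a x) (b x) :=
  (nat_lt.comp (const 0) hL).and <| nat_le.comp
    (nat_mul.comp (nat_mul.comp (primrec_codeDim hc)
      (nat_add.comp (primrec_approxMax hc hk hL) (primrec_approxError hc hk hL))) (nat_pow hb hL))
    (nat_mul.comp (nat_pow ha hL) (primrec_scaleFactor hk hL))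

theorem primrecPred_lowerCertificate (hc : Primrec c) (hk : Primrec k) (hL : Primrec L)
    (ha : Primrec a) (hb : Primrec b) :
    PrimrecPred fun x => LowerCertificate (c x) (k x) (L x) (a x) (b x) := by
  have hN := primrec_codeDim hc
  have hN1 := nat_sub.comp hN (const 1)
  have hNL := nat_mul.comp hN hL
  have hd := nat_mul.comp (nat_pow hb hL) (nat_pow (primrec_scaleFactor hk hL) hN1)
  exact nat_lt.comp
    (nat_add.comp
      (nat_mul.comp (nat_mul.comp (nat_mul.comp (primrec_bochiConst hN) (nat_pow ha hL))
        (nat_pow (nat_add.comp (primrec_approxMax hc hk hL) (primrec_approxError hc hk hL)) hN1))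
        (primrec_scaleFactor hk hNL))
      (nat_mul.comp (primrec_approxError hc hk hNL) hd))
    (nat_mul.comp (primrec_approxMax hc hk hNL) hd)

end CertificatePrimrec

/-! ### Soundness and completeness of the certificates -/

theorem upperCertificate_iff (c : SystemCode) (k L a : ℕ) {b : ℕ} (hb : 0 < b) :
    UpperCertificate c k L a b ↔ 0 < L ∧
      (codeDim c : ℝ) * ((approxMax c k L + approxError c k L : ℕ) / (2 ^ k * 2 ^ k) ^ L) ≤
        ((a : ℝ) / b) ^ L := by
  have hb' : (0 : ℝ) < b := by exact_mod_cast hb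
  rw [UpperCertificate, ← Nat.cast_le (α := ℝ), div_pow, ← mul_div_assoc,
    div_le_div_iff₀ (by positivity) (by positivity), scaleFactor]
  push_cast
  rfl

theorem lowerCertificate_iff (c : SystemCode) (k L a : ℕ) {b : ℕ} (hb : 0 < b) :
    LowerCertificate c k L a b ↔
      bochiConst (codeDim c) * ((a : ℝ) / b) ^ L *
          ((approxMax c k L + approxError c k L : ℕ) / (2 ^ k * 2 ^ k) ^ L) ^ (codeDim c - 1) +
        approxError c k (codeDim c * L) / (2 ^ k * 2 ^ k) ^ (codeDim c * L) <
      (approxMax c k (codeDim c * L) : ℝ) / (2 ^ k * 2 ^ k) ^ (codeDim c * L) := by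
  have hb' : (0 : ℝ) < b := by exact_mod_cast hb
  rw [LowerCertificate, ← Nat.cast_lt (α := ℝ)]
  simp only [scaleFactor]
  push_cast
  set N := codeDim c
  set E : ℝ := (2 ^ k * 2 ^ k) ^ L with hE
  set E' : ℝ := (2 ^ k * 2 ^ k) ^ (N * L) with hE'
  have hE0 : 0 < E := by positivity
  have hE0' : 0 < E' := by positivity
  have hW : 0 < (b : ℝ) ^ L * E ^ (N - 1) := by positivity
  have h1 : ∀ x y z : ℝ, x * ((a : ℝ) / b) ^ L * (y / E) ^ (N - 1) + z / E' =
      (x * (a : ℝ) ^ L * y ^ (N - 1) * E' + z * ((b : ℝ) ^ L * E ^ (N - 1))) /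
        (E' * ((b : ℝ) ^ L * E ^ (N - 1))) := by
    intro x y z
    rw [div_pow, div_pow]
    field_simp
  have h2 : ∀ z : ℝ, z / E' = z * ((b : ℝ) ^ L * E ^ (N - 1)) /
      (E' * ((b : ℝ) ^ L * E ^ (N - 1))) := fun z => (mul_div_mul_right _ _ hW.ne').symm
  rw [h1, h2 (approxMax c k (N * L)), div_lt_div_iff_of_pos_right (by positivity)]

namespace SwitchedDelaySystem

variable {n m : ℕ} {D : Finset ℕ} {S : SwitchedDelaySystem n m D ℝ}
  {q : ℕ → SwitchedDelaySystem n m D ℤ}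

theorem codeDim_code (q : SwitchedDelaySystem n m D ℤ) :
    codeDim q.code = Fintype.card (Fin n ⊕ Fin (D.sup id) × Fin m) := by
  rw [codeDim, listMaxDelay_code]
  simp [code]

theorem IsName.productsBounded (h : S.IsName q) {k L a b : ℕ} (hb : 0 < b) {c : ℝ} (hc : 0 < c)
    (hac : (a : ℝ) / b ≤ c) (hu : UpperCertificate (q k).code k L a b) :
    ProductsBounded S.trans c := by
  obtain ⟨hL, hle⟩ := (upperCertificate_iff _ _ _ _ hb).1 hu
  rw [codeDim_code] at hle
  exact (h.entriesBounded k L).productsBounded hL hc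
    (hle.trans (pow_le_pow_left₀ (by positivity) hac L))

/-- Boundedness would cap the true entries at length `N * L`, hence the approximate ones up to
`approxError`; the certificate asserts a larger approximate entry. -/
theorem IsName.not_productsBounded (h : S.IsName q) {k L a b : ℕ} (hb : 0 < b) {c : ℝ}
    (hc : 0 < c) (hca : c ≤ (a : ℝ) / b) (hl : LowerCertificate (q k).code k L a b) :
    ¬ ProductsBounded S.trans c := by
  rw [lowerCertificate_iff _ _ _ _ hb, codeDim_code] at hl
  by_contra hbd
  have hE := h.entriesBounded k L
  set N := Fintype.card (Fin n ⊕ Fin (D.sup id) × Fin m)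
  set X : ℝ := (approxMax (q k).code k L + approxError (q k).code k L : ℕ) /
    (2 ^ k * 2 ^ k) ^ L with hX
  have hX0 : 0 ≤ X := by positivity
  have hNL : EntriesBounded S.trans (N * L) (bochiConst N * ((a : ℝ) / b) ^ L * X ^ (N - 1)) := by
    intro w hw i j
    by_contra hlt
    refine not_productsBounded_of_lt hE hc hw (lt_of_le_of_lt ?_ (not_le.1 hlt)) hbd
    have : c ^ L ≤ ((a : ℝ) / b) ^ L := pow_le_pow_left₀ hc.le hca L
    gcongr
  exact not_le.2 hl (h.approxMax_div_le k (by positivity) hNL)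

theorem nonempty_of_lowerCertificate (q : SwitchedDelaySystem n m D ℤ) {k L a b : ℕ}
    (hl : LowerCertificate q.code k L a b) :
    Nonempty (Fin n ⊕ Fin (D.sup id) × Fin m) := by
  by_contra hne
  rw [not_nonempty_iff] at hne
  have h0 : approxMax q.code k (codeDim q.code * L) = 0 := by
    have := (approxMax_le_iff q k (codeDim q.code * L) le_rfl).2 fun w _ j => isEmptyElim j
    rw [mul_zero] at this
    exact_mod_cast this.antisymm (Nat.cast_nonneg _)
  rw [LowerCertificate, h0, zero_mul] at hl
  exact absurd hl (Nat.not_lt_zero _)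

/-- The strict inequality survives small perturbations. The error enters twice: in `approxMax`, and
in the margin added to it. The threshold `a k / b k` may vary with `k`, since in the comparison `r`
itself is only approximated. -/
theorem IsName.eventually_upperCertificate (h : S.IsName q) {L : ℕ} (hL : 0 < L) {X c : ℝ}
    (hX0 : 0 ≤ X) (hX : EntriesBounded S.trans L X)
    (hXc : Fintype.card (Fin n ⊕ Fin (D.sup id) × Fin m) * X < c ^ L) {a b : ℕ → ℕ}
    (hb : ∀ k, 0 < b k)
    (hab : Filter.Tendsto (fun k => (a k : ℝ) / b k) Filter.atTop (nhds c)) :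
    ∀ᶠ k in Filter.atTop, UpperCertificate (q k).code k L (a k) (b k) := by
  have he := h.tendsto_approxError L
  have h1 := ((he.const_mul 2).const_add X).const_mul
    (Fintype.card (Fin n ⊕ Fin (D.sup id) × Fin m) : ℝ)
  rw [mul_zero, add_zero] at h1
  filter_upwards [h1.eventually_lt (hab.pow L) hXc] with k hk
  rw [upperCertificate_iff _ _ _ _ (hb k), codeDim_code]
  refine ⟨hL, le_trans ?_ hk.le⟩
  refine mul_le_mul_of_nonneg_left ?_ (Nat.cast_nonneg _)
  have := h.approxMax_div_le k hX0 hX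
  rw [Nat.cast_add, add_div]
  linarith

theorem IsName.eventually_lowerCertificate (h : S.IsName q) {L : ℕ} {X c : ℝ}
    (hX0 : 0 ≤ X) (hX : EntriesBounded S.trans L X) {w : List D}
    (hw : w.length = Fintype.card (Fin n ⊕ Fin (D.sup id) × Fin m) * L) {i j}
    (hlt : bochiConst (Fintype.card (Fin n ⊕ Fin (D.sup id) × Fin m)) * c ^ L *
      X ^ (Fintype.card (Fin n ⊕ Fin (D.sup id) × Fin m) - 1) < |(w.map S.trans).prod i j|)
    {a b : ℕ → ℕ} (hb : ∀ k, 0 < b k)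
    (hab : Filter.Tendsto (fun k => (a k : ℝ) / b k) Filter.atTop (nhds c)) :
    ∀ᶠ k in Filter.atTop, LowerCertificate (q k).code k L (a k) (b k) := by
  set N := Fintype.card (Fin n ⊕ Fin (D.sup id) × Fin m) with hN
  have h1 := (((hab.pow L).const_mul (bochiConst N : ℝ)).mul
    ((((h.tendsto_approxError L).const_mul 2).const_add X).pow (N - 1))).add
    ((h.tendsto_approxError (N * L)).const_mul 2)
  simp only [mul_zero, add_zero] at h1
  filter_upwards [h1.eventually_lt_const hlt] with k hk
  rw [lowerCertificate_iff _ _ _ _ (hb k), codeDim_code, ← hN]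
  have h2 := h.entriesBounded k (N * L) w hw i j
  have h3 := h.approxMax_div_le k hX0 hX
  rw [Nat.cast_add, add_div] at h2 ⊢
  have h4 : (approxMax (q k).code k L : ℝ) / (2 ^ k * 2 ^ k) ^ L +
      approxError (q k).code k L / (2 ^ k * 2 ^ k) ^ L ≤
      X + 2 * (approxError (q k).code k L / (2 ^ k * 2 ^ k) ^ L) := by linarith
  have h5 := mul_le_mul_of_nonneg_left (pow_le_pow_left₀ (by positivity) h4 (N - 1))
    (show 0 ≤ (bochiConst N : ℝ) * ((a k : ℝ) / b k) ^ L by positivity)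
  linarith

end SwitchedDelaySystem

/-! ### The algorithms -/

theorem exists_outputs {α β : Type} {f : ℕ × α → Option β} {q : ℕ → α}
    (h : ∃ k, (f (k, q k)).isSome) : ∃ b, Outputs f q b := by
  classical
  obtain ⟨b, hb⟩ := Option.isSome_iff_exists.1 (Nat.find_spec h)
  refine ⟨b, Nat.find h, hb, fun j hj => ?_⟩
  simpa using Nat.find_min h hj

/-- The estimate of the growth rate with precision `2 / (e + 1)`.  A run at the precision level `k`
tries one candidate and two lengths of products, so that all combinations are tried at arbitrarily
high levels. -/
def estimate (e : ℕ) (x : ℕ × SystemCode) : Option (ℕ × ℕ) :=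
  if UpperCertificate x.2 x.1 x.1.unpair.2.unpair.1 (x.1.unpair.1 + 2) (e + 1) ∧
      (x.1.unpair.1 ≤ 1 ∨
        LowerCertificate x.2 x.1 x.1.unpair.2.unpair.2.unpair.1 (x.1.unpair.1 - 1) (e + 1)) then
    some (x.1.unpair.1, e)
  else none

/-- The comparison of the growth rate with a real number, with precision `1 / (e + 1)`. -/
def compareRate (e : ℕ) (x : ℕ × (SystemCode × ℤ)) : Option Bool :=
  if UpperCertificate x.2.1 x.1 x.1.unpair.1 ((x.2.2 + -1) * (e + 1 : ℕ) + 2 ^ x.1).toNat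
      (2 ^ x.1 * (e + 1)) then some true
  else if LowerCertificate x.2.1 x.1 x.1.unpair.1
      ((x.2.2 + 1) * (e + 1 : ℕ) + -1 * 2 ^ x.1).toNat (2 ^ x.1 * (e + 1)) then some false
  else none

section Computable

open Primrec

theorem primrec_estimate (e : ℕ) : Primrec (estimate e) := by
  have hu1 : Primrec fun x : ℕ × SystemCode => x.1.unpair := unpair.comp fst
  have hu2 : Primrec fun x : ℕ × SystemCode => x.1.unpair.2.unpair :=
    unpair.comp (snd.comp hu1)
  have hu3 : Primrec fun x : ℕ × SystemCode => x.1.unpair.2.unpair.2.unpair :=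
    unpair.comp (snd.comp hu2)
  have hj := fst.comp hu1
  exact Primrec.ite
    ((primrecPred_upperCertificate snd fst (fst.comp hu2) (nat_add.comp hj (const 2))
      (const (e + 1))).and ((nat_le.comp hj (const 1)).or
      (primrecPred_lowerCertificate snd fst (fst.comp hu3) (nat_sub.comp hj (const 1))
        (const (e + 1)))))
    (option_some.comp (hj.pair (const e))) (const none)

theorem primrec_compareRate (e : ℕ) : Primrec (compareRate e) := by
  have hc : Primrec fun x : ℕ × (SystemCode × ℤ) => x.2.1 := fst.comp snd
  have hp : Primrec fun x : ℕ × (SystemCode × ℤ) => x.2.2 := snd.comp snd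
  have hL : Primrec fun x : ℕ × (SystemCode × ℤ) => x.1.unpair.1 := fst.comp (unpair.comp fst)
  have hb : Primrec fun x : ℕ × (SystemCode × ℤ) => 2 ^ x.1 * (e + 1) :=
    nat_mul.comp (nat_pow (const 2) fst) (const (e + 1))
  have h2 : Primrec fun x : ℕ × (SystemCode × ℤ) => (2 : ℤ) ^ x.1 := primrec_int_two_pow fst
  exact Primrec.ite
    (primrecPred_upperCertificate hc fst hL
      (int_toNat.comp (int_add (int_mul (int_add hp (const (-1))) (const ((e + 1 : ℕ) : ℤ))) h2))
      hb) (const (some true))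
    (Primrec.ite
      (primrecPred_lowerCertificate hc fst hL
        (int_toNat.comp (int_add (int_mul (int_add hp (const 1)) (const ((e + 1 : ℕ) : ℤ)))
          (int_mul (const (-1)) h2))) hb)
      (const (some false)) (const none))

end Computable

/-! ### Correctness and termination of the algorithms -/

theorem toNat_div_eq_max (z : ℤ) {b : ℝ} (hb : 0 < b) : (z.toNat : ℝ) / b = max (z / b) 0 := by
  have h1 : (z.toNat : ℝ) = max (z : ℝ) 0 := by
    have := congrArg (Int.cast (R := ℝ)) (Int.toNat_eq_max z)
    rwa [Int.cast_max, Int.cast_zero, Int.cast_natCast] at this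
  rw [h1, ← max_div_div_right hb.le, zero_div]

namespace SwitchedDelaySystem

variable {n m : ℕ} {D : Finset ℕ} {S : SwitchedDelaySystem n m D ℝ}
  {q : ℕ → SwitchedDelaySystem n m D ℤ}

theorem compare_upper_eq (p : ℤ) (k e : ℕ) :
    ((((p + -1) * (e + 1 : ℕ) + 2 ^ k).toNat : ℕ) : ℝ) / (2 ^ k * (e + 1) : ℕ) =
      max ((p : ℝ) / 2 ^ k - 1 / 2 ^ k + 1 / (e + 1)) 0 := by
  rw [toNat_div_eq_max _ (by positivity)]
  congr 1
  push_cast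
  field_simp
  ring

theorem compare_lower_eq (p : ℤ) (k e : ℕ) :
    ((((p + 1) * (e + 1 : ℕ) + -1 * 2 ^ k).toNat : ℕ) : ℝ) / (2 ^ k * (e + 1) : ℕ) =
      max ((p : ℝ) / 2 ^ k + 1 / 2 ^ k - 1 / (e + 1)) 0 := by
  rw [toNat_div_eq_max _ (by positivity)]
  congr 1
  push_cast
  field_simp
  ring

/-- The tested threshold uses `(p k - 1) / 2 ^ k ≤ r`, so it never exceeds `r + 1 / (e + 1)`,
however coarse the approximation. -/
theorem IsName.compare_true (h : S.IsName q) {r : ℝ} (hr : 0 < r) {p : ℕ → ℤ}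
    (hp : IsDyadicName r p) {e k : ℕ} (hc : compareRate e (k, (q k).code, p k) = some true) :
    ProductsBounded S.trans (r + 1 / (e + 1)) := by
  have hu : UpperCertificate (q k).code k k.unpair.1 ((p k + -1) * (e + 1 : ℕ) + 2 ^ k).toNat
      (2 ^ k * (e + 1)) := by
    by_contra hu
    simp only [compareRate, hu, if_false] at hc
    split_ifs at hc
    exact Bool.false_ne_true (Option.some_inj.1 hc)
  refine h.productsBounded (by positivity) (by positivity) ?_ hu
  rw [compare_upper_eq]
  have := (abs_le.1 (hp k)).1
  exact max_le (by linarith) (by positivity)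

theorem IsName.compare_false (h : S.IsName q) (hD : D.Nonempty) {r : ℝ} {p : ℕ → ℤ}
    (hp : IsDyadicName r p) {e k : ℕ} (hc : compareRate e (k, (q k).code, p k) = some false) :
    S.GrowthAtLeast (max (r - 1 / (e + 1)) 0) := by
  have hl : LowerCertificate (q k).code k k.unpair.1
      ((p k + 1) * (e + 1 : ℕ) + -1 * 2 ^ k).toNat (2 ^ k * (e + 1)) := by
    by_contra hl
    by_cases hu : UpperCertificate (q k).code k k.unpair.1
      ((p k + -1) * (e + 1 : ℕ) + 2 ^ k).toNat (2 ^ k * (e + 1))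
    · simp only [compareRate, hu, if_true] at hc
      exact Bool.false_ne_true (Option.some_inj.1 hc).symm
    · simp only [compareRate, hu, hl, if_false] at hc
      exact absurd hc (by simp)
  -- At rate zero unboundedness is not needed, only a nonzero extended state. A lower certificate
  -- guarantees one, as it cannot hold in dimension zero.
  rcases (le_max_right (r - 1 / ((e : ℝ) + 1)) 0).eq_or_lt with h0 | h0
  · obtain ⟨i⟩ := nonempty_of_lowerCertificate (q k) hl
    rw [← h0]
    exact growthAtLeast_zero S hD i
  · refine growthAtLeast_of_not_productsBounded hD h0
      (h.not_productsBounded (by positivity) h0 ?_ hl)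
    rw [compare_lower_eq]
    have := (abs_le.1 (hp k)).2
    exact max_le_max (by linarith) le_rfl

/-- The unused component of the pair makes `k`, and with it the precision, arbitrarily large while
the search parameter `a` stays fixed. -/
theorem exists_le_unpair {P : ℕ → Prop} (hP : ∀ᶠ k in Filter.atTop, P k) (a : ℕ) :
    ∃ k, P k ∧ k.unpair.1 = a := by
  obtain ⟨K, hK⟩ := Filter.eventually_atTop.1 hP
  exact ⟨Nat.pair a K, hK _ (Nat.right_le_pair a K), by rw [Nat.unpair_pair]⟩

theorem IsName.exists_compare (h : S.IsName q) {r : ℝ} (hr : 0 < r) {p : ℕ → ℤ}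
    (hp : IsDyadicName r p) (e : ℕ) : ∃ k, (compareRate e (k, (q k).code, p k)).isSome := by
  have hpow : Filter.Tendsto (fun k : ℕ => 1 / (2 : ℝ) ^ k) Filter.atTop (nhds 0) := by
    simpa only [one_div_pow] using
      tendsto_pow_atTop_nhds_zero_of_lt_one (r := (1 / 2 : ℝ)) (by norm_num) (by norm_num)
  have hpk := isDyadicName_tendsto hp
  have he : (0 : ℝ) < 1 / (e + 1) := by positivity
  by_cases hbd : ProductsBounded S.trans r
  · obtain ⟨L, hL, X, hX0, hX, hlt⟩ :=
      hbd.exists_entriesBounded hr.le (show r < r + 1 / (e + 1) by linarith)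
    have hlim : Filter.Tendsto (fun k =>
        ((((p k + -1) * (e + 1 : ℕ) + 2 ^ k).toNat : ℕ) : ℝ) / (2 ^ k * (e + 1) : ℕ))
        Filter.atTop (nhds (r + 1 / (e + 1))) := by
      simp only [compare_upper_eq]
      have := ((hpk.sub hpow).add_const (1 / ((e : ℝ) + 1))).max
        (tendsto_const_nhds (x := (0 : ℝ)))
      rwa [sub_zero, max_eq_left (by positivity)] at this
    obtain ⟨k, hk, rfl⟩ := exists_le_unpair
      (h.eventually_upperCertificate hL hX0 hX hlt (fun k => by positivity) hlim) L
    exact ⟨k, by simp only [compareRate, hk, if_true]; rfl⟩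
  · obtain ⟨L, hL, X, hX0, hX, w, hw, i, j, hlt⟩ := exists_lt_of_not_productsBounded hbd
      -- The maximum with `r / 2` makes the rate positive while keeping it below `r`. Afterwards
      -- monotonicity replaces it by the limit of the tested thresholds, which are truncated at
      -- zero.
      (c := max (r - 1 / (e + 1)) (r / 2)) (lt_max_of_lt_right (by positivity))
      (max_lt (by linarith) (by linarith))
    have hlim : Filter.Tendsto (fun k =>
        ((((p k + 1) * (e + 1 : ℕ) + -1 * 2 ^ k).toNat : ℕ) : ℝ) / (2 ^ k * (e + 1) : ℕ))
        Filter.atTop (nhds (max (r - 1 / (e + 1)) 0)) := by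
      simp only [compare_lower_eq]
      have := ((hpk.add hpow).sub_const (1 / ((e : ℝ) + 1))).max
        (tendsto_const_nhds (x := (0 : ℝ)))
      rwa [add_zero] at this
    have hlt' := lt_of_le_of_lt (mul_le_mul_of_nonneg_right (mul_le_mul_of_nonneg_left
      (pow_le_pow_left₀ (le_max_right _ _)
        (max_le_max (le_refl (r - 1 / ((e : ℝ) + 1))) (half_pos hr).le) L) (Nat.cast_nonneg _))
      (pow_nonneg hX0 _)) hlt
    obtain ⟨k, hk, rfl⟩ := exists_le_unpair
      (h.eventually_lowerCertificate hX0 hX hw hlt' (fun k => by positivity) hlim) L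
    refine ⟨k, ?_⟩
    simp only [compareRate, hk, if_true]
    split_ifs <;> rfl

theorem growthRate_bounds (hD : D.Nonempty) {a b : ℝ} (hb : 0 < b)
    (hbd : ProductsBounded S.trans b) (ha : 0 < a → ¬ ProductsBounded S.trans a) :
    S.growthRate ≠ ⊤ ∧ a ≤ S.growthRate.toReal ∧ S.growthRate.toReal ≤ b := by
  have hup : ∀ c, b < c → S.growthRate ≤ ENNReal.ofReal c := fun c hc =>
    growthRate_le_of_growthAtMost hb.le hc (growthAtMost_of_productsBounded hbd)
  have htop : S.growthRate ≠ ⊤ :=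
    ((hup (b + 1) (by linarith)).trans_lt ENNReal.ofReal_lt_top).ne
  refine ⟨htop, ?_, ?_⟩
  · rcases le_or_gt a 0 with ha0 | ha0
    · exact ha0.trans ENNReal.toReal_nonneg
    · refine le_of_forall_lt_imp_le_of_dense fun c hc => ?_
      rcases le_or_gt c 0 with hc0 | hc0
      · exact hc0.trans ENNReal.toReal_nonneg
      · exact (ENNReal.ofReal_le_iff_le_toReal htop).1 (le_growthRate_of_growthAtLeast hc0.le hc
          (growthAtLeast_of_not_productsBounded hD ha0 (ha ha0)))
  · refine le_of_forall_gt_imp_ge_of_dense fun c hc => ?_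
    exact ENNReal.toReal_le_of_le_ofReal (hb.trans hc).le (hup c hc)

theorem IsName.estimate_some (h : S.IsName q) (hD : D.Nonempty) {e k : ℕ} {c : ℕ × ℕ}
    (hc : estimate e (k, (q k).code) = some c) :
    S.growthRate ≠ ⊤ ∧
      |S.growthRate.toReal - (c.1 : ℝ) / ((c.2 : ℝ) + 1)| ≤ 2 / (e + 1) := by
  rw [estimate] at hc
  split_ifs at hc with hcert
  obtain ⟨hu, hl⟩ := hcert
  rw [Option.some_inj] at hc
  subst hc
  dsimp only at hu hl ⊢
  set j := k.unpair.1 with hj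
  have he : (0 : ℝ) < (e : ℝ) + 1 := by positivity
  have hbd := h.productsBounded (c := ((j : ℝ) + 2) / (e + 1)) (by positivity) (by positivity)
    (le_of_eq (by push_cast; rfl)) hu
  have ha : 0 < ((j : ℝ) - 1) / (e + 1) → ¬ ProductsBounded S.trans (((j : ℝ) - 1) / (e + 1)) := by
    intro hpos
    have hj1 : 1 < j := by
      have := (div_pos_iff_of_pos_right he).1 hpos
      rw [sub_pos] at this
      exact_mod_cast this
    refine h.not_productsBounded (by positivity) hpos (le_of_eq ?_)
      (hl.resolve_left (not_le.2 hj1))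
    rw [Nat.cast_sub hj1.le]
    push_cast
    rfl
  obtain ⟨h1, h2, h3⟩ := growthRate_bounds hD (by positivity) hbd ha
  refine ⟨h1, abs_le.2 ⟨?_, ?_⟩⟩
  · rw [sub_div] at h2
    have : (1 : ℝ) / (e + 1) ≤ 2 / (e + 1) := by gcongr; norm_num
    linarith
  · rw [add_div] at h3
    linarith

/-- Take the least `j` with boundedness at `(j + 1) / (e + 1)`. It then fails at `j / (e + 1)` if `j
≥ 1`. Moving one grid step outwards gives the gaps that completeness needs, hence the thresholds `j
+ 2` and `j - 1` in `estimate`; for `j ≤ 1` the lower one is vacuous. -/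
theorem IsName.exists_estimate (h : S.IsName q) (e : ℕ) :
    ∃ k, (estimate e (k, (q k).code)).isSome := by
  have he : (0 : ℝ) < (e : ℝ) + 1 := by positivity
  have hex : ∃ j : ℕ, ProductsBounded S.trans (((j : ℝ) + 1) / (e + 1)) := by
    obtain ⟨b, hb, hbw⟩ := exists_abs_list_prod_le S.trans
    obtain ⟨j, hj⟩ := exists_nat_ge (b * (e + 1))
    have hb' : ProductsBounded S.trans b := ⟨1, fun w i j => by rw [one_mul]; exact hbw w i j⟩
    refine ⟨j, hb'.mono hb.le ?_⟩
    rw [le_div_iff₀ he]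
    linarith
  classical
  set j := Nat.find hex with hj
  obtain ⟨L, hL, X, hX0, hX, hlt⟩ := (Nat.find_spec hex).exists_entriesBounded (by positivity)
    (show ((j : ℝ) + 1) / (e + 1) < ((j : ℝ) + 2) / (e + 1) by gcongr; norm_num)
  have hup := h.eventually_upperCertificate hL hX0 hX hlt (a := fun _ => j + 2)
    (b := fun _ => e + 1) (fun _ => by positivity) (by push_cast; exact tendsto_const_nhds)
  obtain ⟨L', hlow⟩ : ∃ L', ∀ᶠ k in Filter.atTop,
      j ≤ 1 ∨ LowerCertificate (q k).code k L' (j - 1) (e + 1) := by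
    rcases le_or_gt j 1 with hj1 | hj1
    · exact ⟨0, Filter.Eventually.of_forall fun _ => Or.inl hj1⟩
    · have hnb := Nat.find_min hex (m := j - 1) (by omega)
      rw [Nat.cast_sub hj1.le, Nat.cast_one, sub_add_cancel] at hnb
      have hj1' : (1 : ℝ) < j := by exact_mod_cast hj1
      obtain ⟨L', -, X', hX0', hX', w, hw, i, i', hlt'⟩ := exists_lt_of_not_productsBounded hnb
        (c := ((j : ℝ) - 1) / (e + 1)) (div_pos (by linarith) he) (by gcongr; linarith)
      refine ⟨L', (h.eventually_lowerCertificate hX0' hX' hw hlt' (a := fun _ => j - 1)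
        (b := fun _ => e + 1) (fun _ => by positivity) ?_).mono fun k hk => Or.inr hk⟩
      rw [Nat.cast_sub hj1.le]
      push_cast
      exact tendsto_const_nhds
  obtain ⟨K, hK⟩ := Filter.eventually_atTop.1 (hup.and hlow)
  have hk := hK (Nat.pair j (Nat.pair L (Nat.pair L' K)))
    ((Nat.right_le_pair _ _).trans ((Nat.right_le_pair _ _).trans (Nat.right_le_pair _ _)))
  refine ⟨Nat.pair j (Nat.pair L (Nat.pair L' K)), ?_⟩
  rw [estimate, if_pos]
  · rfl
  · simp only [Nat.unpair_pair]
    exact hk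

end SwitchedDelaySystem

theorem mainTheorem4 (ε : ℝ) (hε : 0 < ε) :
    (∃ est : ℕ × SystemCode → Option (ℕ × ℕ), Computable est ∧
      ∀ (n m : ℕ) (D : Finset ℕ), D.Nonempty →
      ∀ (S : SwitchedDelaySystem n m D ℝ) (q : ℕ → SwitchedDelaySystem n m D ℤ), S.IsName q →
        ∃ c : ℕ × ℕ, Outputs est (fun k => (q k).code) c ∧
          S.growthRate ≠ ⊤ ∧
          |S.growthRate.toReal - (c.1 : ℝ) / ((c.2 : ℝ) + 1)| ≤ ε) ∧
    (∃ dec : ℕ × (SystemCode × ℤ) → Option Bool, Computable dec ∧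
      ∀ (n m : ℕ) (D : Finset ℕ), D.Nonempty →
      ∀ (S : SwitchedDelaySystem n m D ℝ) (q : ℕ → SwitchedDelaySystem n m D ℤ), S.IsName q →
      ∀ (r : ℝ) (p : ℕ → ℤ), 0 < r → IsDyadicName r p →
        ∃ b : Bool, Outputs dec (fun k => ((q k).code, p k)) b ∧
          (b = true → S.GrowthAtMost (r + ε)) ∧
          (b = false → S.GrowthAtLeast (max (r - ε) 0))) := by
  -- The number `ε` is fixed, so `e` is a constant of the algorithm and need not be computed from
  -- `ε`. Half of `ε` is used because the estimate may be off by two grid steps.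
  obtain ⟨e, he⟩ := exists_nat_one_div_lt (half_pos hε)
  have he2 : 2 / ((e : ℝ) + 1) ≤ ε := by
    have : 2 / ((e : ℝ) + 1) = 2 * (1 / (e + 1)) := by ring
    linarith
  have he1 : 1 / ((e : ℝ) + 1) ≤ ε := by linarith
  refine ⟨⟨estimate e, (primrec_estimate e).to_comp, ?_⟩,
    ⟨compareRate e, (primrec_compareRate e).to_comp, ?_⟩⟩
  · intro n m D hD S q h
    obtain ⟨c, k, hk, hk'⟩ := exists_outputs (h.exists_estimate e)
    have := h.estimate_some hD hk
    exact ⟨c, ⟨k, hk, hk'⟩, this.1, this.2.trans he2⟩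
  · intro n m D hD S q h r p hr hp
    obtain ⟨b, k, hk, hk'⟩ := exists_outputs (q := fun k => ((q k).code, p k))
      (h.exists_compare hr hp e)
    refine ⟨b, ⟨k, hk, hk'⟩, ?_, ?_⟩
    · rintro rfl
      exact SwitchedDelaySystem.growthAtMost_of_productsBounded
        ((h.compare_true hr hp hk).mono (by positivity) (by linarith))
    · rintro rfl
      obtain ⟨C, hC, τ, hτ⟩ := h.compare_false hD hp hk
      refine ⟨C, hC, τ, fun t => le_trans ?_ (hτ t)⟩
      have : max (r - ε) 0 ≤ max (r - 1 / ((e : ℝ) + 1)) 0 := max_le_max (by linarith) le_rfl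
      gcongr
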